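/- Let $R$ be an associative ring with $1$. For Gabriel filters $\mathcal F_l$ of left ideals and $\mathcal F_r$ of right ideals of $R$, the induced symmetric filter ${}_l\mathcal F_r$ is the set of right ideals of $R\otimes_{\mathbb Z}R^{op}$ that contain $J\otimes R^{op}+R\otimes I$ for some $I\in\mathcal F_l$ and $J\in\mathcal F_r$. View $R$-bimodules as right $R\otimes_{\mathbb Z}R^{op}$-modules by $x\cdot(r\otimes s)=sxr$. Let $t(R)$ be the set of elements of $R$ annihilated by a member of ${}_l\mathcal F_r$. The symmetric ring of quotients is ${}_lR_r=\varinjlim_{K\in{}_l\mathcal F_r}\mathrm{Hom}_{R\otimes R^{op}}(K,R/t(R))$, with its canonical ring homomorphism $q_R:R\to{}_lR_r$. A ring homomorphism $f:R\to S$ makes $S$ a perfect symmetric ring of quotients of $R$ if $\mathcal F_l=\{I\mid Sf(I)=S\}$ is a left Gabriel filter, $\mathcal F_r=\{J\mid f(J)S=S\}$ is a right Gabriel filter, and there is a ring isomorphism $g:S\to{}_lR_r$ with $g\circ f=q_R$. The filter ${}_l\mathcal F_r$ is then called a perfect symmetric filter. A symmetric filter ${}_l\mathcal F_r$ is called differential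 if for every derivation $D$ of the ring $R\otimes_{\mathbb Z}R^{op}$ (in particular for $D=\delta\otimes 1+1\otimes\delta$ with $\delta$ a derivation of $R$) and every $K\in{}_l\mathcal F_r$ there is $L\in{}_l\mathcal F_r$ with $D(L)\subseteq K$. Let $Q^\sigma_{\max}(R)\supseteq R$ be the maximal symmetric ring of quotients, i.e. ${}_lR_r$ for the filters of all dense left and all dense right ideals. (1) Every perfect symmetric filter is differential. (2) Among the subrings of $Q^\sigma_{\max}(R)$ containing $R$ that are perfect symmetric rings of quotients of $R$ (via the inclusion of $R$) there is a largest one, the total symmetric ring of quotients $Q^\sigma_{\mathrm{tot}}(R)$; it is the subring generated by all of them. Every derivation $\delta$ of $R$ extends uniquely to a derivation of the ring $Q^\sigma_{\mathrm{tot}}(R)$. -/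

import Mathlib

open scoped TensorProduct

universe u v w

namespace SymQuot

/-! ### Derivations, right ideals, Gabriel filters -/

/-- A derivation of a (not necessarily commutative) ring. -/
structure RingDerivation (A : Type u) [Ring A] extends A →+ A where
  leibniz : ∀ x y : A, toFun (x * y) = toFun x * y + x * toFun y

instance (A : Type u) [Ring A] : CoeFun (RingDerivation A) (fun _ => A → A) :=
  ⟨fun D => D.toFun⟩

/-- Right ideals; left ideals are `Ideal A`. -/
abbrev RightIdeal (A : Type u) [Ring A] : Type u := Submodule Aᵐᵒᵖ A

/-- The left ideal `(I : a) = {x | x a ∈ I}`. -/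
def leftColon {A : Type u} [Ring A] (I : Ideal A) (a : A) : Ideal A where
  carrier := {x | x * a ∈ I}
  zero_mem' := by simp
  add_mem' := by
    intro x y hx hy
    simpa [add_mul] using I.add_mem hx hy
  smul_mem' := by
    intro c x hx
    simpa [mul_assoc] using I.mul_mem_left c hx

theorem RightIdeal.mul_mem {A : Type u} [Ring A] (J : RightIdeal A) {x : A} (hx : x ∈ J) (a : A) :
    x * a ∈ J := J.smul_mem (MulOpposite.op a) hx

/-- The right ideal `(J : a) = {x | a x ∈ J}`. -/
def rightColon {A : Type u} [Ring A] (J : RightIdeal A) (a : A) : RightIdeal A where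
  carrier := {x | a * x ∈ J}
  zero_mem' := by simp
  add_mem' := by
    intro x y hx hy
    simpa [mul_add] using J.add_mem hx hy
  smul_mem' := by
    intro c x hx
    simpa [mul_assoc] using RightIdeal.mul_mem J hx c.unop

theorem mem_leftColon {A : Type u} [Ring A] {I : Ideal A} {a x : A} :
    x ∈ leftColon I a ↔ x * a ∈ I := Iff.rfl

theorem mem_rightColon {A : Type u} [Ring A] {J : RightIdeal A} {a x : A} :
    x ∈ rightColon J a ↔ a * x ∈ J := Iff.rfl

/-- A Gabriel filter of left ideals. -/
structure LeftGabrielFilter (A : Type u) [Ring A] where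
  sets : Set (Ideal A)
  top_mem : ⊤ ∈ sets
  mono : ∀ I ∈ sets, ∀ J : Ideal A, I ≤ J → J ∈ sets
  inf_mem : ∀ I ∈ sets, ∀ J ∈ sets, I ⊓ J ∈ sets
  colon_mem : ∀ I ∈ sets, ∀ a : A, leftColon I a ∈ sets
  mem_of_colon : ∀ I ∈ sets, ∀ J : Ideal A, (∀ a ∈ I, leftColon J a ∈ sets) → J ∈ sets

/-- A Gabriel filter of right ideals. -/
structure RightGabrielFilter (A : Type u) [Ring A] where
  sets : Set (RightIdeal A)
  top_mem : ⊤ ∈ sets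
  mono : ∀ I ∈ sets, ∀ J : RightIdeal A, I ≤ J → J ∈ sets
  inf_mem : ∀ I ∈ sets, ∀ J ∈ sets, I ⊓ J ∈ sets
  colon_mem : ∀ I ∈ sets, ∀ a : A, rightColon I a ∈ sets
  mem_of_colon : ∀ I ∈ sets, ∀ J : RightIdeal A, (∀ a ∈ I, rightColon J a ∈ sets) → J ∈ sets

/-! ### The enveloping ring and symmetric filters -/

/-- The enveloping ring `R ⊗ Rᵒᵖ` over the integers. -/
abbrev Env (R : Type u) [Ring R] : Type u := R ⊗[ℤ] Rᵐᵒᵖ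

section Basic

variable {R : Type u} [Ring R] {A : Type v} [Ring A]

/-- For a ring homomorphism `π : R → A`, the `R`-bimodule `A` is a right module over `R ⊗ Rᵒᵖ` by
`x · (r ⊗ s) = π s * x * π r`. -/
def biAct (π : R →+* A) (x : A) : Env R →+ A :=
  TensorProduct.liftAddHom
    { toFun := fun r =>
        { toFun := fun s => π s.unop * x * π r
          map_zero' := by simp
          map_add' := by intro s s'; simp [add_mul] }
      map_zero' := by ext; simp
      map_add' := by intro r r'; ext; simp [mul_add] }
    (by
      intro n r s
      change π s.unop * x * π (n • r) = π (n • s).unop * x * π r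
      rw [map_zsmul, MulOpposite.unop_smul, map_zsmul, mul_smul_comm, smul_mul_assoc,
        smul_mul_assoc])

@[simp] theorem biAct_tmul (π : R →+* A) (x : A) (r : R) (s : Rᵐᵒᵖ) :
    biAct π x (r ⊗ₜ s) = π s.unop * x * π r := rfl

theorem biAct_mul (π : R →+* A) (x : A) (t t' : Env R) :
    biAct π x (t * t') = biAct π (biAct π x t) t' := by
  induction t' using TensorProduct.induction_on with
  | zero => simp
  | add a b ha hb => simp [mul_add, ha, hb]
  | tmul r' s' =>
    induction t using TensorProduct.induction_on with
    | zero => simp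
    | add a b ha hb => simp only [add_mul, map_add, ha, hb, biAct_tmul, mul_add]
    | tmul r s => simp [mul_assoc]

theorem biAct_zero (π : R →+* A) (t : Env R) : biAct π 0 t = 0 := by
  induction t using TensorProduct.induction_on with
  | zero => simp
  | add a b ha hb => simp [ha, hb]
  | tmul r s => simp

theorem biAct_sub (π : R →+* A) (x y : A) (t : Env R) :
    biAct π (x - y) t = biAct π x t - biAct π y t := by
  induction t using TensorProduct.induction_on with
  | zero => simp
  | add a b ha hb => simp only [map_add, ha, hb]; abel
  | tmul r s => simp [mul_sub, sub_mul]

theorem biAct_add (π : R →+* A) (x y : A) (t : Env R) :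
    biAct π (x + y) t = biAct π x t + biAct π y t := by
  induction t using TensorProduct.induction_on with
  | zero => simp
  | add a b ha hb => simp only [map_add, ha, hb]; abel
  | tmul r s => simp [mul_add, add_mul]

theorem biAct_map {B : Type w} [Ring B] (π : R →+* A) (ρ : A →+* B) (x : A) (t : Env R) :
    biAct (ρ.comp π) (ρ x) t = ρ (biAct π x t) := by
  induction t using TensorProduct.induction_on with
  | zero => simp
  | add a b ha hb => simp [ha, hb]
  | tmul r s => simp

/-- The right ideal `J ⊗ Rᵒᵖ + R ⊗ I` of `R ⊗ Rᵒᵖ`. -/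
def inducedIdeal (I : Ideal R) (J : RightIdeal R) : RightIdeal (Env R) :=
  Submodule.span _ {x | (∃ j ∈ J, ∃ s : Rᵐᵒᵖ, x = j ⊗ₜ[ℤ] s) ∨
    (∃ i ∈ I, ∃ r : R, x = r ⊗ₜ[ℤ] MulOpposite.op i)}

/-- The symmetric filter induced by a left and a right Gabriel filter: all right ideals of
`R ⊗ Rᵒᵖ` containing some `J ⊗ Rᵒᵖ + R ⊗ I`. -/
def symmetricFilter (Fl : LeftGabrielFilter R) (Fr : RightGabrielFilter R) :
    Set (RightIdeal (Env R)) :=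
  {K | ∃ I ∈ Fl.sets, ∃ J ∈ Fr.sets, inducedIdeal I J ≤ K}

theorem inducedIdeal_le {I : Ideal R} {J : RightIdeal R} {K : RightIdeal (Env R)} :
    inducedIdeal I J ≤ K ↔
      (∀ j ∈ J, j ⊗ₜ[ℤ] (1 : Rᵐᵒᵖ) ∈ K) ∧ (∀ i ∈ I, (1 : R) ⊗ₜ[ℤ] MulOpposite.op i ∈ K) := by
  constructor
  · intro h
    exact ⟨fun j hj => h (Submodule.subset_span (Or.inl ⟨j, hj, 1, rfl⟩)),
      fun i hi => h (Submodule.subset_span (Or.inr ⟨i, hi, 1, rfl⟩))⟩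
  · rintro ⟨h1, h2⟩
    refine Submodule.span_le.2 ?_
    rintro x (⟨j, hj, s, rfl⟩ | ⟨i, hi, r, rfl⟩)
    · simpa using RightIdeal.mul_mem K (h1 j hj) ((1 : R) ⊗ₜ[ℤ] s)
    · simpa using RightIdeal.mul_mem K (h2 i hi) (r ⊗ₜ[ℤ] (1 : Rᵐᵒᵖ))

theorem symmetricFilter_inf {Fl : LeftGabrielFilter R} {Fr : RightGabrielFilter R}
    {K L : RightIdeal (Env R)} (hK : K ∈ symmetricFilter Fl Fr) (hL : L ∈ symmetricFilter Fl Fr) :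
    K ⊓ L ∈ symmetricFilter Fl Fr := by
  obtain ⟨I, hI, J, hJ, h⟩ := hK
  obtain ⟨I', hI', J', hJ', h'⟩ := hL
  rw [inducedIdeal_le] at h h'
  refine ⟨I ⊓ I', Fl.inf_mem _ hI _ hI', J ⊓ J', Fr.inf_mem _ hJ _ hJ', inducedIdeal_le.2 ⟨?_, ?_⟩⟩
  · exact fun j hj => ⟨h.1 j hj.1, h'.1 j hj.2⟩
  · exact fun i hi => ⟨h.2 i hi.1, h'.2 i hi.2⟩

/-- A filter of right ideals of `R ⊗ Rᵒᵖ` is differential if, for every derivation `D` of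
`R ⊗ Rᵒᵖ` and every `K` in the filter, there is `L` in the filter with `D L ⊆ K`. -/
def IsDifferential (F : Set (RightIdeal (Env R))) : Prop :=
  ∀ D : RingDerivation (Env R), ∀ K ∈ F, ∃ L ∈ F, ∀ x ∈ L, D x ∈ K

/-! ### The torsion ideal -/

variable (Fl : LeftGabrielFilter R) (Fr : RightGabrielFilter R)

theorem torsion_iff {x : R} :
    (∃ K ∈ symmetricFilter Fl Fr, ∀ k ∈ K, biAct (RingHom.id R) x k = 0) ↔
      (∃ I ∈ Fl.sets, ∀ i ∈ I, i * x = 0) ∧ (∃ J ∈ Fr.sets, ∀ j ∈ J, x * j = 0) := by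
  constructor
  · rintro ⟨K, ⟨I, hI, J, hJ, h⟩, hx⟩
    rw [inducedIdeal_le] at h
    refine ⟨⟨I, hI, fun i hi => ?_⟩, ⟨J, hJ, fun j hj => ?_⟩⟩
    · simpa using hx _ (h.2 i hi)
    · simpa using hx _ (h.1 j hj)
  · rintro ⟨⟨I, hI, hIx⟩, ⟨J, hJ, hJx⟩⟩
    let K : RightIdeal (Env R) :=
      { carrier := {t | biAct (RingHom.id R) x t = 0}
        zero_mem' := by simp
        add_mem' := by
          intro a b ha hb
          simp only [Set.mem_ofPred_eq] at ha hb ⊢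
          simp [ha, hb]
        smul_mem' := by
          intro c a ha
          simp only [Set.mem_ofPred_eq] at ha ⊢
          rw [MulOpposite.smul_eq_mul_unop, biAct_mul, ha, biAct_zero] }
    refine ⟨K, ⟨I, hI, J, hJ, inducedIdeal_le.2 ⟨fun j hj => ?_, fun i hi => ?_⟩⟩, fun k hk => hk⟩
    · change biAct (RingHom.id R) x _ = 0
      simp [hJx j hj]
    · change biAct (RingHom.id R) x _ = 0
      simp [hIx i hi]

/-- The torsion submodule of the bimodule `R` for the torsion theory of the symmetric filter:
the elements annihilated by some member of the filter. -/
def torsionIdeal : Ideal R where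
  carrier := {x | ∃ K ∈ symmetricFilter Fl Fr, ∀ k ∈ K, biAct (RingHom.id R) x k = 0}
  zero_mem' := by
    rw [Set.mem_ofPred_eq, torsion_iff]
    exact ⟨⟨⊤, Fl.top_mem, by simp⟩, ⟨⊤, Fr.top_mem, by simp⟩⟩
  add_mem' := by
    rintro x y ⟨K, hK, hx⟩ ⟨L, hL, hy⟩
    refine ⟨K ⊓ L, symmetricFilter_inf hK hL, fun k hk => ?_⟩
    rw [biAct_add, hx k hk.1, hy k hk.2, add_zero]
  smul_mem' := by
    intro c x hx
    rw [Set.mem_ofPred_eq, torsion_iff] at hx ⊢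
    obtain ⟨⟨I, hI, hIx⟩, ⟨J, hJ, hJx⟩⟩ := hx
    refine ⟨⟨leftColon I c, Fl.colon_mem I hI c, fun i hi => ?_⟩, ⟨J, hJ, fun j hj => ?_⟩⟩
    · rw [smul_eq_mul, ← mul_assoc]; exact hIx _ hi
    · rw [smul_eq_mul, mul_assoc, hJx j hj, mul_zero]

theorem mem_torsionIdeal {x : R} : x ∈ torsionIdeal Fl Fr ↔
    (∃ I ∈ Fl.sets, ∀ i ∈ I, i * x = 0) ∧ (∃ J ∈ Fr.sets, ∀ j ∈ J, x * j = 0) :=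
  torsion_iff Fl Fr

instance : (torsionIdeal Fl Fr).IsTwoSided where
  mul_mem_of_left := by
    intro a b ha
    rw [mem_torsionIdeal] at ha ⊢
    obtain ⟨⟨I, hI, hIx⟩, ⟨J, hJ, hJx⟩⟩ := ha
    refine ⟨⟨I, hI, fun i hi => ?_⟩, ⟨rightColon J b, Fr.colon_mem J hJ b, fun j hj => ?_⟩⟩
    · rw [← mul_assoc, hIx i hi, zero_mul]
    · rw [mul_assoc]; exact hJx _ hj

/-- The torsion-free quotient ring `R / t(R)`. -/
abbrev FreePart : Type u := R ⧸ torsionIdeal Fl Fr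

/-- The projection `R → R / t(R)`. -/
abbrev toFree : R →+* FreePart Fl Fr := Ideal.Quotient.mk (torsionIdeal Fl Fr)

theorem left_dense {J : Ideal R} {I : Ideal R} (hI : I ∈ Fl.sets)
    (h : ∀ a ∈ I, ∃ C ∈ Fl.sets, ∀ c ∈ C, c * a ∈ J) : J ∈ Fl.sets :=
  Fl.mem_of_colon I hI J fun a ha =>
    let ⟨C, hC, hCa⟩ := h a ha
    Fl.mono C hC _ hCa

theorem right_dense {J : RightIdeal R} {I : RightIdeal R} (hI : I ∈ Fr.sets)
    (h : ∀ a ∈ I, ∃ C ∈ Fr.sets, ∀ c ∈ C, a * c ∈ J) : J ∈ Fr.sets :=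
  Fr.mem_of_colon I hI J fun a ha =>
    let ⟨C, hC, hCa⟩ := h a ha
    Fr.mono C hC _ hCa

/-- Left annihilator of an element as a left ideal. -/
def annL (x : A) : Ideal A where
  carrier := {a | a * x = 0}
  zero_mem' := by simp
  add_mem' := by
    intro a b ha hb
    simp only [Set.mem_ofPred_eq] at ha hb ⊢
    simp [add_mul, ha, hb]
  smul_mem' := by
    intro c a ha
    simp only [Set.mem_ofPred_eq] at ha ⊢
    simp [mul_assoc, ha]

/-- Right annihilator of an element as a right ideal. -/
def annR (x : A) : RightIdeal A where
  carrier := {a | x * a = 0}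
  zero_mem' := by simp
  add_mem' := by
    intro a b ha hb
    simp only [Set.mem_ofPred_eq] at ha hb ⊢
    simp [mul_add, ha, hb]
  smul_mem' := by
    intro c a ha
    simp only [Set.mem_ofPred_eq] at ha ⊢
    simp [← mul_assoc, ha]

theorem free_eq_zero {u : FreePart Fl Fr}
    (hl : ∃ I ∈ Fl.sets, ∀ i ∈ I, toFree Fl Fr i * u = 0)
    (hr : ∃ J ∈ Fr.sets, ∀ j ∈ J, u * toFree Fl Fr j = 0) : u = 0 := by
  obtain ⟨v, rfl⟩ := Ideal.Quotient.mk_surjective u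
  obtain ⟨I, hI, h1⟩ := hl
  obtain ⟨J, hJ, h2⟩ := hr
  rw [Ideal.Quotient.eq_zero_iff_mem, mem_torsionIdeal]
  constructor
  · refine ⟨annL v, left_dense Fl hI fun a ha => ?_, fun i hi => hi⟩
    have := h1 a ha
    rw [← map_mul, Ideal.Quotient.eq_zero_iff_mem, mem_torsionIdeal] at this
    obtain ⟨⟨C, hC, hCa⟩, -⟩ := this
    exact ⟨C, hC, fun c hc => by simpa [annL, mul_assoc] using hCa c hc⟩
  · refine ⟨annR v, right_dense Fr hJ fun a ha => ?_, fun i hi => hi⟩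
    have := h2 a ha
    rw [← map_mul, Ideal.Quotient.eq_zero_iff_mem, mem_torsionIdeal] at this
    obtain ⟨-, ⟨C, hC, hCa⟩⟩ := this
    exact ⟨C, hC, fun c hc => by simpa [annR, mul_assoc] using hCa c hc⟩

end Basic

/-! ### The symmetric ring of quotients as a direct limit -/

section Limit

variable {R : Type u} [Ring R] (Fl : LeftGabrielFilter R) (Fr : RightGabrielFilter R)

/-- A homomorphism of right `R ⊗ Rᵒᵖ`-modules `K → R / t(R)`, with `K` in the symmetric filter. -/
structure PartialHom where
  dom : RightIdeal (Env R)
  dom_mem : dom ∈ symmetricFilter Fl Fr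
  toHom : dom →+ FreePart Fl Fr
  map_mul : ∀ (k : dom) (t : Env R),
    toHom (MulOpposite.op t • k) = biAct (toFree Fl Fr) (toHom k) t

/-- Two homomorphisms are identified when they agree on a smaller member of the filter. -/
instance partialHomSetoid : Setoid (PartialHom Fl Fr) where
  r φ ψ := ∃ L ∈ symmetricFilter Fl Fr, ∃ (h₁ : L ≤ φ.dom) (h₂ : L ≤ ψ.dom),
    ∀ (x : Env R) (hx : x ∈ L), φ.toHom ⟨x, h₁ hx⟩ = ψ.toHom ⟨x, h₂ hx⟩
  iseqv :=
    { refl := fun φ => ⟨φ.dom, φ.dom_mem, le_rfl, le_rfl, fun _ _ => rfl⟩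
      symm := by
        rintro φ ψ ⟨L, hL, h₁, h₂, h⟩
        exact ⟨L, hL, h₂, h₁, fun x hx => (h x hx).symm⟩
      trans := by
        rintro φ ψ χ ⟨L, hL, h₁, h₂, h⟩ ⟨L', hL', h₁', h₂', h'⟩
        exact ⟨L ⊓ L', symmetricFilter_inf hL hL', inf_le_left.trans h₁, inf_le_right.trans h₂',
          fun x hx => (h x hx.1).trans (h' x hx.2)⟩ }

/-- The symmetric ring of quotients of `R`: the direct limit, over `K` in the symmetric filter, of
`Hom(K, R / t(R))`, homomorphisms of right `R ⊗ Rᵒᵖ`-modules. Its ring structure is defined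
below. -/
def SymmetricQuotient : Type u := Quotient (partialHomSetoid Fl Fr)

end Limit

/-! ### Partial endomorphisms -/

section Germ

variable (B : Type u) (M : Type v) [Ring B] [AddCommGroup M] [Module B M]

/-- A family of submodules of `M` on which partial endomorphisms may be defined. -/
structure DomainSystem where
  sets : Set (Submodule B M)
  top_mem : ⊤ ∈ sets
  inf_mem : ∀ N ∈ sets, ∀ N' ∈ sets, N ⊓ N' ∈ sets
  preimage : ∀ N ∈ sets, ∀ N' ∈ sets, ∀ f : M → M,
    (∀ x ∈ N, ∀ y ∈ N, f (x + y) = f x + f y) → (∀ (b : B), ∀ x ∈ N, f (b • x) = b • f x) →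
    ∃ L ∈ sets, L ≤ N ∧ ∀ x ∈ L, f x ∈ N'

variable {B M}

/-- A map which is linear on a member `dom` of the system; its values elsewhere are irrelevant. -/
structure PartialEnd (S : DomainSystem B M) where
  toFun : M → M
  dom : Submodule B M
  dom_mem : dom ∈ S.sets
  map_add : ∀ x ∈ dom, ∀ y ∈ dom, toFun (x + y) = toFun x + toFun y
  map_smul : ∀ (b : B), ∀ x ∈ dom, toFun (b • x) = b • toFun x

variable {S : DomainSystem B M}

theorem PartialEnd.map_zero (f : PartialEnd S) : f.toFun 0 = 0 := by
  simpa using f.map_smul 0 0 f.dom.zero_mem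

/-- Partial endomorphisms are identified when they agree on a member of the system. -/
instance partialEndSetoid (S : DomainSystem B M) : Setoid (PartialEnd S) where
  r f g := ∃ N ∈ S.sets, ∀ x ∈ N, f.toFun x = g.toFun x
  iseqv :=
    { refl := fun f => ⟨⊤, S.top_mem, fun _ _ => rfl⟩
      symm := by
        rintro f g ⟨N, hN, h⟩
        exact ⟨N, hN, fun x hx => (h x hx).symm⟩
      trans := by
        rintro f g k ⟨N, hN, h⟩ ⟨N', hN', h'⟩
        exact ⟨N ⊓ N', S.inf_mem _ hN _ hN', fun x hx => (h x hx.1).trans (h' x hx.2)⟩ }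

/-- The ring of partial endomorphisms, the direct limit of `Hom(N, M)`. -/
def GermEnd (S : DomainSystem B M) : Type v := Quotient (partialEndSetoid S)

namespace PartialEnd

/-- Pointwise sum. -/
def add (f g : PartialEnd S) : PartialEnd S where
  toFun x := f.toFun x + g.toFun x
  dom := f.dom ⊓ g.dom
  dom_mem := S.inf_mem _ f.dom_mem _ g.dom_mem
  map_add x hx y hy := by
    rw [f.map_add x hx.1 y hy.1, g.map_add x hx.2 y hy.2]; abel
  map_smul b x hx := by
    rw [f.map_smul b x hx.1, g.map_smul b x hx.2, smul_add]

/-- Pointwise negative. -/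
def neg (f : PartialEnd S) : PartialEnd S where
  toFun x := - f.toFun x
  dom := f.dom
  dom_mem := f.dom_mem
  map_add x hx y hy := by rw [f.map_add x hx y hy]; abel
  map_smul b x hx := by rw [f.map_smul b x hx, smul_neg]

/-- An everywhere defined endomorphism. -/
def ofLinear (S : DomainSystem B M) (f : M →ₗ[B] M) : PartialEnd S where
  toFun := f
  dom := ⊤
  dom_mem := S.top_mem
  map_add x _ y _ := f.map_add x y
  map_smul b x _ := f.map_smul b x

/-- Composition. -/
noncomputable def comp (f g : PartialEnd S) : PartialEnd S where
  toFun x := f.toFun (g.toFun x)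
  dom := (S.preimage _ g.dom_mem _ f.dom_mem g.toFun g.map_add g.map_smul).choose
  dom_mem := (S.preimage _ g.dom_mem _ f.dom_mem g.toFun g.map_add g.map_smul).choose_spec.1
  map_add x hx y hy := by
    have h := (S.preimage _ g.dom_mem _ f.dom_mem g.toFun g.map_add g.map_smul).choose_spec.2
    rw [g.map_add x (h.1 hx) y (h.1 hy), f.map_add _ (h.2 x hx) _ (h.2 y hy)]
  map_smul b x hx := by
    have h := (S.preimage _ g.dom_mem _ f.dom_mem g.toFun g.map_add g.map_smul).choose_spec.2
    rw [g.map_smul b x (h.1 hx), f.map_smul b _ (h.2 x hx)]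

end PartialEnd

namespace GermEnd

/-- The class of a partial endomorphism. -/
def mk (f : PartialEnd S) : GermEnd S := Quotient.mk _ f

theorem mk_eq {f g : PartialEnd S} :
    mk f = mk g ↔ ∃ N ∈ S.sets, ∀ x ∈ N, f.toFun x = g.toFun x := Quotient.eq

theorem mk_eq_of {f g : PartialEnd S} (h : ∀ x, f.toFun x = g.toFun x) : mk f = mk g :=
  mk_eq.2 ⟨⊤, S.top_mem, fun x _ => h x⟩

instance : Zero (GermEnd S) := ⟨mk (PartialEnd.ofLinear S 0)⟩
instance : One (GermEnd S) := ⟨mk (PartialEnd.ofLinear S LinearMap.id)⟩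

instance : Add (GermEnd S) :=
  ⟨Quotient.map₂ PartialEnd.add (by
    rintro f f' ⟨N, hN, h⟩ g g' ⟨N', hN', h'⟩
    refine ⟨N ⊓ N', S.inf_mem _ hN _ hN', fun x hx => ?_⟩
    simp only [PartialEnd.add, h x hx.1, h' x hx.2])⟩

instance : Neg (GermEnd S) :=
  ⟨Quotient.map PartialEnd.neg (by
    rintro f f' ⟨N, hN, h⟩
    exact ⟨N, hN, fun x hx => by simp only [PartialEnd.neg, h x hx]⟩)⟩

noncomputable instance : Mul (GermEnd S) :=
  ⟨Quotient.map₂ PartialEnd.comp (by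
    rintro f f' ⟨N, hN, h⟩ g g' ⟨N', hN', h'⟩
    obtain ⟨L, hL, -, hL2⟩ := S.preimage _ g.dom_mem _ hN g.toFun g.map_add g.map_smul
    refine ⟨L ⊓ N', S.inf_mem _ hL _ hN', fun x hx => ?_⟩
    simp only [PartialEnd.comp]
    rw [h _ (hL2 x hx.1), h' x hx.2])⟩

theorem mk_add (f g : PartialEnd S) : mk f + mk g = mk (f.add g) := rfl
theorem mk_neg (f : PartialEnd S) : - mk f = mk f.neg := rfl
theorem mk_mul (f g : PartialEnd S) : mk f * mk g = mk (f.comp g) := rfl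
theorem zero_def : (0 : GermEnd S) = mk (PartialEnd.ofLinear S 0) := rfl
theorem one_def : (1 : GermEnd S) = mk (PartialEnd.ofLinear S LinearMap.id) := rfl

theorem ind {p : GermEnd S → Prop} (h : ∀ f, p (mk f)) (x : GermEnd S) : p x := Quotient.ind h x

noncomputable instance : Ring (GermEnd S) where
  add_assoc x y z := by
    induction x using ind; induction y using ind; induction z using ind
    exact mk_eq_of fun x => add_assoc _ _ _
  zero_add x := by
    induction x using ind
    exact mk_eq_of fun x => zero_add _
  add_zero x := by
    induction x using ind
    exact mk_eq_of fun x => add_zero _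
  add_comm x y := by
    induction x using ind; induction y using ind
    exact mk_eq_of fun x => add_comm _ _
  neg_add_cancel x := by
    induction x using ind
    exact mk_eq_of fun x => neg_add_cancel _
  mul_assoc x y z := by
    induction x using ind; induction y using ind; induction z using ind
    exact mk_eq_of fun x => rfl
  one_mul x := by
    induction x using ind
    exact mk_eq_of fun x => rfl
  mul_one x := by
    induction x using ind
    exact mk_eq_of fun x => rfl
  zero_mul x := by
    induction x using ind
    exact mk_eq_of fun x => rfl
  mul_zero x := by
    induction x using ind with
    | h f => exact mk_eq_of fun x => f.map_zero
  right_distrib x y z := by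
    induction x using ind; induction y using ind; induction z using ind
    exact mk_eq_of fun x => rfl
  left_distrib x y z := by
    induction x using ind with
    | h f =>
    induction y using ind with
    | h g =>
    induction z using ind with
    | h k =>
    obtain ⟨L, hL, -, h⟩ := S.preimage _ g.dom_mem _ f.dom_mem g.toFun g.map_add g.map_smul
    obtain ⟨L', hL', -, h'⟩ := S.preimage _ k.dom_mem _ f.dom_mem k.toFun k.map_add k.map_smul
    exact mk_eq.2 ⟨L ⊓ L', S.inf_mem _ hL _ hL',
      fun x hx => f.map_add _ (h x hx.1) _ (h' x hx.2)⟩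
  nsmul := nsmulRec
  zsmul := zsmulRec

end GermEnd

end Germ

/-! ### Compatible pairs -/

section Pairs

variable {R : Type u} [Ring R] (Fl : LeftGabrielFilter R) (Fr : RightGabrielFilter R)

/-- The left ideals of `R / t(R)` which contain the image of a member of `Fl`. -/
def leftSystem : DomainSystem (FreePart Fl Fr) (FreePart Fl Fr) where
  sets := {N | ∃ I ∈ Fl.sets, ∀ i ∈ I, toFree Fl Fr i ∈ N}
  top_mem := ⟨⊤, Fl.top_mem, fun _ _ => trivial⟩
  inf_mem := by
    rintro N ⟨I, hI, h⟩ N' ⟨I', hI', h'⟩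
    exact ⟨I ⊓ I', Fl.inf_mem _ hI _ hI', fun i hi => ⟨h i hi.1, h' i hi.2⟩⟩
  preimage := by
    rintro N ⟨I, hI, h⟩ N' ⟨I', hI', h'⟩ f hadd hsmul
    let L : Ideal (FreePart Fl Fr) :=
      { carrier := {x | x ∈ N ∧ f x ∈ N'}
        zero_mem' := ⟨N.zero_mem, by
          have := hsmul 0 0 N.zero_mem
          simp only [smul_zero, zero_smul] at this
          rw [this]; exact N'.zero_mem⟩
        add_mem' := by
          rintro x y ⟨hx, hx'⟩ ⟨hy, hy'⟩
          exact ⟨N.add_mem hx hy, by rw [hadd x hx y hy]; exact N'.add_mem hx' hy'⟩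
        smul_mem' := by
          rintro c x ⟨hx, hx'⟩
          exact ⟨N.smul_mem c hx, by rw [hsmul c x hx]; exact N'.smul_mem c hx'⟩ }
    refine ⟨L, ⟨L.comap (toFree Fl Fr), left_dense Fl hI fun a ha => ?_, fun i hi => hi⟩,
      fun x hx => hx.1, fun x hx => hx.2⟩
    obtain ⟨c, hc⟩ := Ideal.Quotient.mk_surjective (f (toFree Fl Fr a))
    refine ⟨leftColon I' c, Fl.colon_mem I' hI' c, fun b hb => ?_⟩
    rw [Ideal.mem_comap, map_mul]
    refine ⟨N.smul_mem _ (h a ha), ?_⟩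
    have := hsmul (toFree Fl Fr b) _ (h a ha)
    rw [smul_eq_mul, smul_eq_mul, ← hc, ← map_mul, ← map_mul] at this
    rw [← map_mul, this]
    exact h' _ hb

/-- The right ideals of `R / t(R)` which contain the image of a member of `Fr`. -/
def rightSystem : DomainSystem (FreePart Fl Fr)ᵐᵒᵖ (FreePart Fl Fr) where
  sets := {N | ∃ J ∈ Fr.sets, ∀ j ∈ J, toFree Fl Fr j ∈ N}
  top_mem := ⟨⊤, Fr.top_mem, fun _ _ => trivial⟩
  inf_mem := by
    rintro N ⟨I, hI, h⟩ N' ⟨I', hI', h'⟩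
    exact ⟨I ⊓ I', Fr.inf_mem _ hI _ hI', fun i hi => ⟨h i hi.1, h' i hi.2⟩⟩
  preimage := by
    rintro N ⟨I, hI, h⟩ N' ⟨I', hI', h'⟩ f hadd hsmul
    let L : RightIdeal (FreePart Fl Fr) :=
      { carrier := {x | x ∈ N ∧ f x ∈ N'}
        zero_mem' := ⟨N.zero_mem, by
          have := hsmul 0 0 N.zero_mem
          simp only [smul_zero, zero_smul] at this
          rw [this]; exact N'.zero_mem⟩
        add_mem' := by
          rintro x y ⟨hx, hx'⟩ ⟨hy, hy'⟩
          exact ⟨N.add_mem hx hy, by rw [hadd x hx y hy]; exact N'.add_mem hx' hy'⟩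
        smul_mem' := by
          rintro c x ⟨hx, hx'⟩
          exact ⟨N.smul_mem c hx, by rw [hsmul c x hx]; exact N'.smul_mem c hx'⟩ }
    let C : RightIdeal R :=
      { carrier := {x | toFree Fl Fr x ∈ L}
        zero_mem' := by
          rw [Set.mem_ofPred_eq, map_zero]; exact L.zero_mem
        add_mem' := by
          intro x y hx hy
          rw [Set.mem_ofPred_eq, map_add]; exact L.add_mem hx hy
        smul_mem' := by
          intro c x hx
          rw [Set.mem_ofPred_eq, MulOpposite.smul_eq_mul_unop, map_mul]
          exact RightIdeal.mul_mem L hx _ }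
    refine ⟨L, ⟨C, right_dense Fr hI fun a ha => ?_, fun i hi => hi⟩,
      fun x hx => hx.1, fun x hx => hx.2⟩
    obtain ⟨c, hc⟩ := Ideal.Quotient.mk_surjective (f (toFree Fl Fr a))
    refine ⟨rightColon I' c, Fr.colon_mem I' hI' c, fun b hb => ?_⟩
    change toFree Fl Fr (a * b) ∈ L
    rw [map_mul]
    refine ⟨RightIdeal.mul_mem N (h a ha) _, ?_⟩
    have := hsmul (MulOpposite.op (toFree Fl Fr b)) _ (h a ha)
    rw [MulOpposite.smul_eq_mul_unop, MulOpposite.smul_eq_mul_unop, MulOpposite.unop_op, ← hc,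
      ← map_mul, ← map_mul] at this
    rw [← map_mul, this]
    exact h' _ hb

/-- The ring of pairs `(f, g)`, `f` a partial endomorphism of the left module and `g` a partial
endomorphism of the right module `R / t(R)`, with `f(x) y = x g(y)`. Products are
`(f, g) (f', g') = (f' ∘ f, g ∘ g')`. -/
noncomputable def PairRing :
    Subring ((GermEnd (leftSystem Fl Fr))ᵐᵒᵖ × GermEnd (rightSystem Fl Fr)) where
  carrier := {p | ∃ (f : PartialEnd (leftSystem Fl Fr)) (g : PartialEnd (rightSystem Fl Fr)),
    p = (MulOpposite.op (GermEnd.mk f), GermEnd.mk g) ∧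
    ∀ x ∈ f.dom, ∀ y ∈ g.dom, f.toFun x * y = x * g.toFun y}
  mul_mem' := by
    rintro _ _ ⟨f, g, rfl, h⟩ ⟨f', g', rfl, h'⟩
    have hf := (DomainSystem.preimage _ _ f.dom_mem _ f'.dom_mem
      f.toFun f.map_add f.map_smul).choose_spec.2
    have hg := (DomainSystem.preimage _ _ g'.dom_mem _ g.dom_mem
      g'.toFun g'.map_add g'.map_smul).choose_spec.2
    refine ⟨f'.comp f, g.comp g', rfl, fun x hx y hy => ?_⟩
    simp only [PartialEnd.comp]
    rw [h' _ (hf.2 x hx) _ (hg.1 hy), h _ (hf.1 hx) _ (hg.2 y hy)]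
  one_mem' := ⟨PartialEnd.ofLinear _ LinearMap.id, PartialEnd.ofLinear _ LinearMap.id, rfl,
    fun _ _ _ _ => rfl⟩
  add_mem' := by
    rintro _ _ ⟨f, g, rfl, h⟩ ⟨f', g', rfl, h'⟩
    refine ⟨f.add f', g.add g', rfl, fun x hx y hy => ?_⟩
    simp only [PartialEnd.add, add_mul, mul_add]
    rw [h x hx.1 y hy.1, h' x hx.2 y hy.2]
  zero_mem' := ⟨PartialEnd.ofLinear _ 0, PartialEnd.ofLinear _ 0, rfl,
    fun x _ y _ => by simp [PartialEnd.ofLinear]⟩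
  neg_mem' := by
    rintro _ ⟨f, g, rfl, h⟩
    refine ⟨f.neg, g.neg, rfl, fun x hx y hy => ?_⟩
    simp only [PartialEnd.neg, neg_mul, mul_neg]
    rw [h x hx y hy]

/-- Left multiplication as an endomorphism of the right module. -/
def leftMul {A : Type u} [Ring A] (a : A) : A →ₗ[Aᵐᵒᵖ] A where
  toFun x := a * x
  map_add' := mul_add a
  map_smul' c x := by simp [mul_assoc]

/-- Right multiplication as an endomorphism of the left module. -/
def rightMul {A : Type u} [Ring A] (a : A) : A →ₗ[A] A where
  toFun x := x * a
  map_add' x y := add_mul x y a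
  map_smul' c x := by simp [mul_assoc]

/-- The embedding of `R / t(R)`: an element goes to its right and left multiplications. -/
noncomputable def pairOf : FreePart Fl Fr →+* PairRing Fl Fr where
  toFun a := ⟨(MulOpposite.op (GermEnd.mk (PartialEnd.ofLinear _ (rightMul a))),
      GermEnd.mk (PartialEnd.ofLinear _ (leftMul a))),
    ⟨_, _, rfl, fun x _ y _ => mul_assoc x a y⟩⟩
  map_one' := Subtype.ext (Prod.ext
    (congrArg MulOpposite.op (GermEnd.mk_eq_of fun x => mul_one x))
    (GermEnd.mk_eq_of fun x => one_mul x))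
  map_mul' a b := Subtype.ext (Prod.ext
    (congrArg MulOpposite.op (GermEnd.mk_eq_of fun x => (mul_assoc x a b).symm))
    (GermEnd.mk_eq_of fun x => mul_assoc a b x))
  map_zero' := Subtype.ext (Prod.ext
    (congrArg MulOpposite.op (GermEnd.mk_eq_of fun x => mul_zero x))
    (GermEnd.mk_eq_of fun x => zero_mul x))
  map_add' a b := Subtype.ext (Prod.ext
    (congrArg MulOpposite.op (GermEnd.mk_eq_of fun x => mul_add x a b))
    (GermEnd.mk_eq_of fun x => add_mul a b x))

variable {Fl Fr}

theorem left_unit {N : Ideal (FreePart Fl Fr)} (hN : N ∈ (leftSystem Fl Fr).sets)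
    {u : FreePart Fl Fr} (h : ∀ x ∈ N, x * u = 0) :
    ∃ I ∈ Fl.sets, ∀ i ∈ I, toFree Fl Fr i * u = 0 :=
  let ⟨I, hI, hIN⟩ := hN
  ⟨I, hI, fun i hi => h _ (hIN i hi)⟩

theorem right_unit {N : RightIdeal (FreePart Fl Fr)} (hN : N ∈ (rightSystem Fl Fr).sets)
    {u : FreePart Fl Fr} (h : ∀ x ∈ N, u * x = 0) :
    ∃ J ∈ Fr.sets, ∀ j ∈ J, u * toFree Fl Fr j = 0 :=
  let ⟨J, hJ, hJN⟩ := hN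
  ⟨J, hJ, fun j hj => h _ (hJN j hj)⟩

theorem pairOf_injective : Function.Injective (pairOf Fl Fr) := by
  rw [injective_iff_map_eq_zero]
  intro a ha
  have h1 := congrArg (fun p => p.1.1.unop) ha
  have h2 := congrArg (fun p => p.1.2) ha
  obtain ⟨N, hN, h1⟩ := GermEnd.mk_eq.1 h1
  obtain ⟨N', hN', h2⟩ := GermEnd.mk_eq.1 h2
  exact free_eq_zero Fl Fr (left_unit hN h1) (right_unit hN' h2)

theorem pair_exists (p : PairRing Fl Fr) :
    (∃ I ∈ Fl.sets, ∀ i ∈ I, ∃ a, pairOf Fl Fr a = pairOf Fl Fr (toFree Fl Fr i) * p) ∧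
    (∃ J ∈ Fr.sets, ∀ j ∈ J, ∃ a, pairOf Fl Fr a = p * pairOf Fl Fr (toFree Fl Fr j)) := by
  obtain ⟨_, f, g, rfl, h⟩ := p
  constructor
  · obtain ⟨I, hI, hIf⟩ := f.dom_mem
    refine ⟨I, hI, fun i hi => ⟨f.toFun (toFree Fl Fr i), ?_⟩⟩
    refine Subtype.ext (Prod.ext (congrArg MulOpposite.op ?_) ?_)
    · exact GermEnd.mk_eq_of fun x => (f.map_smul x _ (hIf i hi)).symm
    · exact GermEnd.mk_eq.2 ⟨g.dom, g.dom_mem, fun y hy => h _ (hIf i hi) y hy⟩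
  · obtain ⟨J, hJ, hJg⟩ := g.dom_mem
    refine ⟨J, hJ, fun j hj => ⟨g.toFun (toFree Fl Fr j), ?_⟩⟩
    refine Subtype.ext (Prod.ext (congrArg MulOpposite.op ?_) ?_)
    · exact GermEnd.mk_eq.2 ⟨f.dom, f.dom_mem, fun x hx => (h x hx _ (hJg j hj)).symm⟩
    · exact GermEnd.mk_eq_of fun x => (g.map_smul (MulOpposite.op x) _ (hJg j hj)).symm

theorem pair_eq_zero {p : PairRing Fl Fr}
    (hl : ∃ I ∈ Fl.sets, ∀ i ∈ I, pairOf Fl Fr (toFree Fl Fr i) * p = 0)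
    (hr : ∃ J ∈ Fr.sets, ∀ j ∈ J, p * pairOf Fl Fr (toFree Fl Fr j) = 0) : p = 0 := by
  obtain ⟨_, f, g, rfl, h⟩ := p
  obtain ⟨I, hI, hl⟩ := hl
  obtain ⟨J, hJ, hr⟩ := hr
  obtain ⟨I', hI', hIf⟩ := f.dom_mem
  obtain ⟨J', hJ', hJg⟩ := g.dom_mem
  have key : ∀ (N : Ideal R), N ≤ I' → (∀ i ∈ N, pairOf Fl Fr (f.toFun (toFree Fl Fr i)) = 0) →
      N ∈ Fl.sets → GermEnd.mk f = 0 := by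
    intro N hN hz hNl
    refine GermEnd.mk_eq.2 ⟨N.map (toFree Fl Fr), ⟨N, hNl, fun i hi => Ideal.mem_map_of_mem _ hi⟩,
      fun x hx => ?_⟩
    obtain ⟨i, hi, rfl⟩ := (Ideal.mem_map_iff_of_surjective _ Ideal.Quotient.mk_surjective).1 hx
    exact pairOf_injective (by rw [hz i hi]; exact (map_zero _).symm)
  have key' : ∀ (N : RightIdeal R), N ≤ J' →
      (∀ i ∈ N, pairOf Fl Fr (g.toFun (toFree Fl Fr i)) = 0) →
      N ∈ Fr.sets → GermEnd.mk g = 0 := by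
    intro N hN hz hNl
    let N' : RightIdeal (FreePart Fl Fr) :=
      { carrier := {x | ∃ i ∈ N, toFree Fl Fr i = x}
        zero_mem' := ⟨0, N.zero_mem, map_zero _⟩
        add_mem' := by
          rintro _ _ ⟨i, hi, rfl⟩ ⟨j, hj, rfl⟩
          exact ⟨i + j, N.add_mem hi hj, map_add _ _ _⟩
        smul_mem' := by
          rintro c _ ⟨i, hi, rfl⟩
          obtain ⟨d, hd⟩ := Ideal.Quotient.mk_surjective c.unop
          exact ⟨i * d, RightIdeal.mul_mem N hi d, by
            rw [map_mul, MulOpposite.smul_eq_mul_unop, hd]⟩ }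
    refine GermEnd.mk_eq.2 ⟨N', ⟨N, hNl, fun i hi => ⟨i, hi, rfl⟩⟩, ?_⟩
    rintro _ ⟨i, hi, rfl⟩
    exact pairOf_injective (by rw [hz i hi]; exact (map_zero _).symm)
  refine Subtype.ext (Prod.ext (congrArg MulOpposite.op
    (key (I ⊓ I') inf_le_right (fun i hi => ?_) (Fl.inf_mem _ hI _ hI')))
    (key' (J ⊓ J') inf_le_right (fun j hj => ?_) (Fr.inf_mem _ hJ _ hJ')))
  · rw [← hl i hi.1]
    refine Subtype.ext (Prod.ext (congrArg MulOpposite.op ?_) ?_)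
    · exact GermEnd.mk_eq_of fun x => (f.map_smul x _ (hIf i hi.2)).symm
    · exact GermEnd.mk_eq.2 ⟨g.dom, g.dom_mem, fun y hy => h _ (hIf i hi.2) y hy⟩
  · rw [← hr j hj.1]
    refine Subtype.ext (Prod.ext (congrArg MulOpposite.op ?_) ?_)
    · exact GermEnd.mk_eq.2 ⟨f.dom, f.dom_mem, fun x hx => (h x hx _ (hJg j hj.2)).symm⟩
    · exact GermEnd.mk_eq_of fun x => (g.map_smul (MulOpposite.op x) _ (hJg j hj.2)).symm

variable (Fl Fr) in
/-- The homomorphism from `R` to the ring of pairs. -/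
noncomputable abbrev toPair : R →+* PairRing Fl Fr := (pairOf Fl Fr).comp (toFree Fl Fr)

/-- The right ideal `{k | p · k ∈ R / t(R)}`. -/
def pairDom (p : PairRing Fl Fr) : RightIdeal (Env R) where
  carrier := {k | ∃ a, pairOf Fl Fr a = biAct (toPair Fl Fr) p k}
  zero_mem' := ⟨0, by rw [map_zero, map_zero]⟩
  add_mem' := by
    rintro k l ⟨a, ha⟩ ⟨b, hb⟩
    exact ⟨a + b, by rw [map_add, map_add, ha, hb]⟩
  smul_mem' := by
    rintro t k ⟨a, ha⟩
    refine ⟨biAct (toFree Fl Fr) a t.unop, ?_⟩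
    rw [MulOpposite.smul_eq_mul_unop, biAct_mul, ← ha, biAct_map]

/-- The element `p · k` of `R / t(R)`. -/
noncomputable def pairVal (p : PairRing Fl Fr) (k : pairDom p) : FreePart Fl Fr := k.2.choose

theorem pairVal_spec (p : PairRing Fl Fr) (k : pairDom p) :
    pairOf Fl Fr (pairVal p k) = biAct (toPair Fl Fr) p k := k.2.choose_spec

/-- The homomorphism `k ↦ p · k` on `{k | p · k ∈ R / t(R)}`. -/
noncomputable def pairHom (p : PairRing Fl Fr) : PartialHom Fl Fr where
  dom := pairDom p
  dom_mem := by
    obtain ⟨⟨I, hI, h⟩, ⟨J, hJ, h'⟩⟩ := pair_exists p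
    refine ⟨I, hI, J, hJ, inducedIdeal_le.2 ⟨fun j hj => ?_, fun i hi => ?_⟩⟩
    · obtain ⟨a, ha⟩ := h' j hj
      refine ⟨a, ha.trans ?_⟩
      rw [biAct_tmul, MulOpposite.unop_one, map_one, one_mul, RingHom.comp_apply]
    · obtain ⟨a, ha⟩ := h i hi
      refine ⟨a, ha.trans ?_⟩
      rw [biAct_tmul, MulOpposite.unop_op, map_one, mul_one, RingHom.comp_apply]
  toHom :=
    { toFun := pairVal p
      map_zero' := pairOf_injective (by
        rw [pairVal_spec, Submodule.coe_zero, map_zero, map_zero])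
      map_add' := fun k l => pairOf_injective (by
        rw [map_add, pairVal_spec, pairVal_spec, pairVal_spec, Submodule.coe_add, map_add]) }
  map_mul k t := pairOf_injective (by
    change pairOf Fl Fr (pairVal p _) = pairOf Fl Fr (biAct _ (pairVal p k) t)
    rw [← biAct_map, pairVal_spec, pairVal_spec, ← biAct_mul]
    rfl)

theorem pairHom_spec (p : PairRing Fl Fr) (k : (pairHom p).dom) :
    pairOf Fl Fr ((pairHom p).toHom k) = biAct (toPair Fl Fr) p k := pairVal_spec p k

/-- The class of the homomorphism `k ↦ p · k`. -/
noncomputable def ofPair (p : PairRing Fl Fr) : SymmetricQuotient Fl Fr := Quotient.mk _ (pairHom p)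

theorem ofPair_eq {p : PairRing Fl Fr} {φ : PartialHom Fl Fr}
    (h : ∃ L ∈ symmetricFilter Fl Fr, ∃ hL : L ≤ φ.dom, ∀ (x : Env R) (hx : x ∈ L),
      pairOf Fl Fr (φ.toHom ⟨x, hL hx⟩) = biAct (toPair Fl Fr) p x) :
    ofPair p = Quotient.mk _ φ := by
  obtain ⟨L, hL, hle, h⟩ := h
  refine Quotient.sound ⟨L, hL, fun x hx => ⟨_, h x hx⟩, hle, fun x hx => pairOf_injective ?_⟩
  rw [h x hx, pairHom_spec]

theorem ofPair_injective : Function.Injective (ofPair : PairRing Fl Fr → _) := by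
  intro p p' h
  obtain ⟨L, ⟨I, hI, J, hJ, hIJ⟩, h₁, h₂, h⟩ := Quotient.exact h
  have key : ∀ x ∈ L, biAct (toPair Fl Fr) (p - p') x = 0 := by
    intro x hx
    rw [biAct_sub, sub_eq_zero]
    have := congrArg (pairOf Fl Fr) (h x hx)
    rwa [pairHom_spec, pairHom_spec] at this
  rw [inducedIdeal_le] at hIJ
  rw [← sub_eq_zero]
  refine pair_eq_zero ⟨I, hI, fun i hi => ?_⟩ ⟨J, hJ, fun j hj => ?_⟩
  · simpa using key _ (hIJ.2 i hi)
  · simpa using key _ (hIJ.1 j hj)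

theorem ofPair_surjective : Function.Surjective (ofPair : PairRing Fl Fr → _) := by
  intro q
  induction q using Quotient.ind with
  | _ φ =>
  obtain ⟨I, hI, J, hJ, hIJ⟩ := φ.dom_mem
  rw [inducedIdeal_le] at hIJ
  -- the values of the homomorphism on the two kinds of generators
  let F : R → FreePart Fl Fr := fun i =>
    open Classical in if hi : i ∈ I then φ.toHom ⟨_, hIJ.2 i hi⟩ else 0
  let G : R → FreePart Fl Fr := fun j =>
    open Classical in if hj : j ∈ J then φ.toHom ⟨_, hIJ.1 j hj⟩ else 0
  have hF : ∀ i (hi : i ∈ I), F i = φ.toHom ⟨_, hIJ.2 i hi⟩ := fun i hi => dif_pos hi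
  have hG : ∀ j (hj : j ∈ J), G j = φ.toHom ⟨_, hIJ.1 j hj⟩ := fun j hj => dif_pos hj
  have Fadd : ∀ i ∈ I, ∀ i' ∈ I, F (i + i') = F i + F i' := by
    intro i hi i' hi'
    rw [hF _ hi, hF _ hi', hF _ (I.add_mem hi hi'), ← map_add]
    exact congrArg _ (Subtype.ext (by simp [TensorProduct.tmul_add]))
  have Gadd : ∀ i ∈ J, ∀ i' ∈ J, G (i + i') = G i + G i' := by
    intro i hi i' hi'
    rw [hG _ hi, hG _ hi', hG _ (J.add_mem hi hi'), ← map_add]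
    exact congrArg _ (Subtype.ext (by simp [TensorProduct.add_tmul]))
  have Fmul : ∀ i ∈ I, ∀ r : R, F (r * i) = toFree Fl Fr r * F i := by
    intro i hi r
    rw [hF _ hi, hF _ (I.mul_mem_left r hi)]
    have := φ.map_mul ⟨_, hIJ.2 i hi⟩ (1 ⊗ₜ[ℤ] MulOpposite.op r)
    rw [biAct_tmul, map_one, mul_one] at this
    refine Eq.trans (congrArg _ (Subtype.ext ?_)) this
    simp
  have Gmul : ∀ j ∈ J, ∀ r : R, G (j * r) = G j * toFree Fl Fr r := by
    intro i hi r
    rw [hG _ hi, hG _ (RightIdeal.mul_mem J hi r)]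
    have := φ.map_mul ⟨_, hIJ.1 i hi⟩ (r ⊗ₜ[ℤ] 1)
    rw [biAct_tmul, MulOpposite.unop_one, map_one, one_mul] at this
    refine Eq.trans (congrArg _ (Subtype.ext ?_)) this
    simp
  have FG : ∀ i ∈ I, ∀ j ∈ J, F i * toFree Fl Fr j = toFree Fl Fr i * G j := by
    intro i hi j hj
    rw [hF _ hi, hG _ hj]
    have h1 := φ.map_mul ⟨_, hIJ.2 i hi⟩ (j ⊗ₜ[ℤ] 1)
    have h2 := φ.map_mul ⟨_, hIJ.1 j hj⟩ (1 ⊗ₜ[ℤ] MulOpposite.op i)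
    rw [biAct_tmul, MulOpposite.unop_one, map_one, one_mul] at h1
    rw [biAct_tmul, map_one, mul_one, MulOpposite.unop_op] at h2
    rw [← h1, ← h2]
    exact congrArg _ (Subtype.ext (by simp))
  -- the values depend only on the classes modulo torsion
  have Fzero : ∀ i ∈ I, toFree Fl Fr i = 0 → F i = 0 := by
    intro i hi h0
    rw [Ideal.Quotient.eq_zero_iff_mem, mem_torsionIdeal] at h0
    obtain ⟨⟨C, hC, hCi⟩, ⟨D, hD, hDi⟩⟩ := h0
    refine free_eq_zero Fl Fr ⟨C, hC, fun c hc => ?_⟩ ?_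
    · rw [← Fmul i hi c, hCi c hc]
      simpa using Fmul 0 I.zero_mem 0
    · let E : RightIdeal R :=
        { carrier := {x | F i * toFree Fl Fr x = 0}
          zero_mem' := by simp
          add_mem' := by
            intro a b ha hb
            simp only [Set.mem_ofPred_eq] at ha hb ⊢
            rw [map_add, mul_add, ha, hb, add_zero]
          smul_mem' := by
            intro c a ha
            simp only [Set.mem_ofPred_eq] at ha ⊢
            rw [MulOpposite.smul_eq_mul_unop, map_mul, ← mul_assoc, ha, zero_mul] }
      refine ⟨E, right_dense Fr hJ fun j hj => ?_, fun x hx => hx⟩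
      obtain ⟨c, hc⟩ := Ideal.Quotient.mk_surjective (G j)
      refine ⟨rightColon D c, Fr.colon_mem D hD c, fun x hx => ?_⟩
      change F i * toFree Fl Fr (j * x) = 0
      rw [map_mul, ← mul_assoc, FG i hi j hj, ← hc, ← map_mul, ← map_mul, mul_assoc, hDi _ hx,
        map_zero]
  have Gzero : ∀ j ∈ J, toFree Fl Fr j = 0 → G j = 0 := by
    intro j hj h0
    rw [Ideal.Quotient.eq_zero_iff_mem, mem_torsionIdeal] at h0
    obtain ⟨⟨C, hC, hCi⟩, ⟨D, hD, hDi⟩⟩ := h0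
    refine free_eq_zero Fl Fr ?_ ⟨D, hD, fun c hc => ?_⟩
    · let E : Ideal R :=
        { carrier := {x | toFree Fl Fr x * G j = 0}
          zero_mem' := by simp
          add_mem' := by
            intro a b ha hb
            simp only [Set.mem_ofPred_eq] at ha hb ⊢
            rw [map_add, add_mul, ha, hb, add_zero]
          smul_mem' := by
            intro c a ha
            simp only [Set.mem_ofPred_eq] at ha ⊢
            rw [smul_eq_mul, map_mul, mul_assoc, ha, mul_zero] }
      refine ⟨E, left_dense Fl hI fun i hi => ?_, fun x hx => hx⟩
      obtain ⟨c, hc⟩ := Ideal.Quotient.mk_surjective (F i)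
      refine ⟨leftColon C c, Fl.colon_mem C hC c, fun x hx => ?_⟩
      change toFree Fl Fr (x * i) * G j = 0
      rw [map_mul, mul_assoc, ← FG i hi j hj, ← hc, ← map_mul, ← map_mul, ← mul_assoc, hCi _ hx,
        map_zero]
    · rw [← Gmul j hj c, hDi c hc]
      simpa using Gmul 0 J.zero_mem 0
  have Feq : ∀ i ∈ I, ∀ i' ∈ I, toFree Fl Fr i = toFree Fl Fr i' → F i = F i' := by
    intro i hi i' hi' h
    have h1 := Fadd _ (I.sub_mem hi hi') _ hi'
    rw [sub_add_cancel, Fzero _ (I.sub_mem hi hi') (by rw [map_sub, h, sub_self]), zero_add] at h1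
    exact h1
  have Geq : ∀ i ∈ J, ∀ i' ∈ J, toFree Fl Fr i = toFree Fl Fr i' → G i = G i' := by
    intro i hi i' hi' h
    have h1 := Gadd _ (J.sub_mem hi hi') _ hi'
    rw [sub_add_cancel, Gzero _ (J.sub_mem hi hi') (by rw [map_sub, h, sub_self]), zero_add] at h1
    exact h1
  let f' : FreePart Fl Fr → FreePart Fl Fr := fun x =>
    open Classical in if h : ∃ i ∈ I, toFree Fl Fr i = x then F h.choose else 0
  let g' : FreePart Fl Fr → FreePart Fl Fr := fun x =>
    open Classical in if h : ∃ i ∈ J, toFree Fl Fr i = x then G h.choose else 0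
  have hf' : ∀ i ∈ I, f' (toFree Fl Fr i) = F i := by
    intro i hi
    have h : ∃ i' ∈ I, toFree Fl Fr i' = toFree Fl Fr i := ⟨i, hi, rfl⟩
    refine (dif_pos h).trans ?_
    exact Feq _ h.choose_spec.1 _ hi h.choose_spec.2
  have hg' : ∀ i ∈ J, g' (toFree Fl Fr i) = G i := by
    intro i hi
    have h : ∃ i' ∈ J, toFree Fl Fr i' = toFree Fl Fr i := ⟨i, hi, rfl⟩
    refine (dif_pos h).trans ?_
    exact Geq _ h.choose_spec.1 _ hi h.choose_spec.2
  let f : PartialEnd (leftSystem Fl Fr) :=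
    { toFun := f'
      dom :=
        { carrier := {x | ∃ i ∈ I, toFree Fl Fr i = x}
          zero_mem' := ⟨0, I.zero_mem, map_zero _⟩
          add_mem' := by
            rintro _ _ ⟨i, hi, rfl⟩ ⟨j, hj, rfl⟩
            exact ⟨i + j, I.add_mem hi hj, map_add _ _ _⟩
          smul_mem' := by
            rintro c _ ⟨i, hi, rfl⟩
            obtain ⟨d, rfl⟩ := Ideal.Quotient.mk_surjective c
            exact ⟨d * i, I.mul_mem_left d hi, by rw [map_mul, smul_eq_mul]⟩ }
      dom_mem := ⟨I, hI, fun i hi => ⟨i, hi, rfl⟩⟩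
      map_add := by
        rintro _ ⟨i, hi, rfl⟩ _ ⟨j, hj, rfl⟩
        rw [← map_add, hf' i hi, hf' j hj, hf' _ (I.add_mem hi hj), Fadd i hi j hj]
      map_smul := by
        rintro c _ ⟨i, hi, rfl⟩
        obtain ⟨d, rfl⟩ := Ideal.Quotient.mk_surjective c
        rw [smul_eq_mul, smul_eq_mul, ← map_mul, hf' i hi, hf' _ (I.mul_mem_left d hi),
          Fmul i hi d] }
  let g : PartialEnd (rightSystem Fl Fr) :=
    { toFun := g'
      dom :=
        { carrier := {x | ∃ i ∈ J, toFree Fl Fr i = x}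
          zero_mem' := ⟨0, J.zero_mem, map_zero _⟩
          add_mem' := by
            rintro _ _ ⟨i, hi, rfl⟩ ⟨j, hj, rfl⟩
            exact ⟨i + j, J.add_mem hi hj, map_add _ _ _⟩
          smul_mem' := by
            rintro c _ ⟨i, hi, rfl⟩
            obtain ⟨d, hd⟩ := Ideal.Quotient.mk_surjective c.unop
            exact ⟨i * d, RightIdeal.mul_mem J hi d, by
              rw [map_mul, MulOpposite.smul_eq_mul_unop, hd]⟩ }
      dom_mem := ⟨J, hJ, fun i hi => ⟨i, hi, rfl⟩⟩
      map_add := by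
        rintro _ ⟨i, hi, rfl⟩ _ ⟨j, hj, rfl⟩
        rw [← map_add, hg' i hi, hg' j hj, hg' _ (J.add_mem hi hj), Gadd i hi j hj]
      map_smul := by
        rintro c _ ⟨i, hi, rfl⟩
        obtain ⟨d, hd⟩ := Ideal.Quotient.mk_surjective c.unop
        rw [MulOpposite.smul_eq_mul_unop, MulOpposite.smul_eq_mul_unop, ← hd, ← map_mul,
          hg' i hi, hg' _ (RightIdeal.mul_mem J hi d), Gmul i hi d] }
  have hfg : ∀ x ∈ f.dom, ∀ y ∈ g.dom, f.toFun x * y = x * g.toFun y := by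
    rintro _ ⟨i, hi, rfl⟩ _ ⟨j, hj, rfl⟩
    change f' _ * _ = _ * g' _
    rw [hf' i hi, hg' j hj, FG i hi j hj]
  refine ⟨⟨(MulOpposite.op (GermEnd.mk f), GermEnd.mk g), f, g, rfl, hfg⟩, ?_⟩
  set p : PairRing Fl Fr := ⟨(MulOpposite.op (GermEnd.mk f), GermEnd.mk g), f, g, rfl, hfg⟩ with hp
  -- the two homomorphisms agree on a right ideal containing the generators
  let L : RightIdeal (Env R) :=
    { carrier := {x | ∃ hx : x ∈ φ.dom, pairOf Fl Fr (φ.toHom ⟨x, hx⟩) = biAct (toPair Fl Fr) p x}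
      zero_mem' := ⟨φ.dom.zero_mem, by
        rw [map_zero]
        exact (congrArg _ (map_zero φ.toHom)).trans (map_zero _)⟩
      add_mem' := by
        rintro x y ⟨hx, hx'⟩ ⟨hy, hy'⟩
        refine ⟨φ.dom.add_mem hx hy, ?_⟩
        rw [map_add, ← hx', ← hy', ← map_add, ← map_add]
        rfl
      smul_mem' := by
        rintro c x ⟨hx, hx'⟩
        refine ⟨φ.dom.smul_mem c hx, ?_⟩
        have := φ.map_mul ⟨x, hx⟩ c.unop
        refine (congrArg (pairOf Fl Fr) this).trans ?_
        rw [MulOpposite.smul_eq_mul_unop, biAct_mul, ← hx', biAct_map] }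
  refine ofPair_eq ⟨L, ⟨I, hI, J, hJ, inducedIdeal_le.2 ⟨fun j hj => ⟨hIJ.1 j hj, ?_⟩,
    fun i hi => ⟨hIJ.2 i hi, ?_⟩⟩⟩, fun x hx => hx.1, fun x hx => hx.2⟩
  · rw [← hG j hj, ← hg' j hj]
    simp only [biAct_tmul, MulOpposite.unop_one, map_one, one_mul]
    refine Subtype.ext (Prod.ext (congrArg MulOpposite.op ?_) ?_)
    · exact GermEnd.mk_eq.2 ⟨f.dom, f.dom_mem, fun x hx => (hfg x hx _ ⟨j, hj, rfl⟩).symm⟩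
    · exact GermEnd.mk_eq_of fun x => (g.map_smul (MulOpposite.op x) _ ⟨j, hj, rfl⟩).symm
  · rw [← hF i hi, ← hf' i hi]
    simp only [biAct_tmul, MulOpposite.unop_op, map_one, mul_one]
    refine Subtype.ext (Prod.ext (congrArg MulOpposite.op ?_) ?_)
    · exact GermEnd.mk_eq_of fun x => (f.map_smul x _ ⟨i, hi, rfl⟩).symm
    · exact GermEnd.mk_eq.2 ⟨g.dom, g.dom_mem, fun y hy => hfg _ ⟨i, hi, rfl⟩ y hy⟩

variable (Fl Fr)

/-- The direct limit of the `Hom(K, R / t(R))` is in bijection with the ring of pairs. -/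
noncomputable def quotientEquiv : SymmetricQuotient Fl Fr ≃ PairRing Fl Fr :=
  (Equiv.ofBijective ofPair ⟨ofPair_injective, ofPair_surjective⟩).symm

/-- The ring structure of the symmetric ring of quotients. -/
noncomputable instance : Ring (SymmetricQuotient Fl Fr) := (quotientEquiv Fl Fr).ring

/-- The ring isomorphism onto the ring of pairs. -/
noncomputable def quotientRingEquiv : SymmetricQuotient Fl Fr ≃+* PairRing Fl Fr :=
  (quotientEquiv Fl Fr).ringEquiv

/-- `r` goes to the homomorphism `k ↦ r · k` on the whole of `R ⊗ Rᵒᵖ`. -/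
def canonicalHom (r : R) : PartialHom Fl Fr where
  dom := ⊤
  dom_mem := ⟨⊤, Fl.top_mem, ⊤, Fr.top_mem, le_top⟩
  toHom := (biAct (toFree Fl Fr) (toFree Fl Fr r)).comp
    ((⊤ : RightIdeal (Env R)).subtype : (⊤ : RightIdeal (Env R)) →+ Env R)
  map_mul _ _ := biAct_mul _ _ _ _

theorem ofPair_toPair (r : R) :
    ofPair (toPair Fl Fr r) = Quotient.mk _ (canonicalHom Fl Fr r) :=
  ofPair_eq ⟨⊤, (canonicalHom Fl Fr r).dom_mem, le_rfl, fun x _ =>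
    (biAct_map (toFree Fl Fr) (pairOf Fl Fr) (toFree Fl Fr r) x).symm⟩

/-- The canonical map from `R` to its symmetric ring of quotients. -/
noncomputable def canonicalMap : R →+* SymmetricQuotient Fl Fr where
  toFun r := Quotient.mk _ (canonicalHom Fl Fr r)
  map_one' := by
    rw [← ofPair_toPair, map_one]
    exact map_one (quotientRingEquiv Fl Fr).symm
  map_mul' r s := by
    rw [← ofPair_toPair, ← ofPair_toPair, ← ofPair_toPair, map_mul]
    exact map_mul (quotientRingEquiv Fl Fr).symm (toPair Fl Fr r) (toPair Fl Fr s)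
  map_zero' := by
    rw [← ofPair_toPair, map_zero]
    exact map_zero (quotientRingEquiv Fl Fr).symm
  map_add' r s := by
    rw [← ofPair_toPair, ← ofPair_toPair, ← ofPair_toPair, map_add]
    exact map_add (quotientRingEquiv Fl Fr).symm (toPair Fl Fr r) (toPair Fl Fr s)

theorem quotientRingEquiv_canonicalMap (r : R) :
    quotientRingEquiv Fl Fr (canonicalMap Fl Fr r) = toPair Fl Fr r := by
  rw [← RingEquiv.eq_symm_apply]
  exact (ofPair_toPair Fl Fr r).symm

end Pairs

/-! ### Perfect symmetric rings of quotients -/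

section Perfect

variable {R : Type u} [Ring R]

/-- `f : R → S` makes `S` a perfect symmetric ring of quotients, with filters `Fl` and `Fr`:
`Fl = {I | S f(I) = S}`, `Fr = {J | f(J) S = S}`, and there is a ring isomorphism from `S` to the
symmetric ring of quotients carrying `f` to the canonical map. -/
structure IsPerfectWith {S : Type v} [Ring S] (f : R →+* S)
    (Fl : LeftGabrielFilter R) (Fr : RightGabrielFilter R) : Prop where
  left : ∀ I : Ideal R, I ∈ Fl.sets ↔ Submodule.span S (f '' (I : Set R)) = ⊤
  right : ∀ J : RightIdeal R, J ∈ Fr.sets ↔ Submodule.span Sᵐᵒᵖ (f '' (J : Set R)) = ⊤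
  iso : ∃ g : S ≃+* SymmetricQuotient Fl Fr, ∀ r : R, g (f r) = canonicalMap Fl Fr r

/-- `f : R → S` makes `S` a perfect symmetric ring of quotients of `R`. -/
def IsPerfectSymmetric {S : Type v} [Ring S] (f : R →+* S) : Prop :=
  ∃ (Fl : LeftGabrielFilter R) (Fr : RightGabrielFilter R), IsPerfectWith f Fl Fr

/-- A perfect symmetric filter: one that is induced by the filters `{I | S f(I) = S}` and
`{J | f(J) S = S}` of a perfect symmetric ring of quotients `f : R → S`. -/
def IsPerfectFilter (F : Set (RightIdeal (Env R))) : Prop :=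
  ∃ (S : Type u) (_ : Ring S) (f : R →+* S) (Fl : LeftGabrielFilter R)
    (Fr : RightGabrielFilter R), IsPerfectWith f Fl Fr ∧ F = symmetricFilter Fl Fr

end Perfect

/-! ### The maximal and the total symmetric rings of quotients -/

section Total

variable (R : Type u) [Ring R]

/-- The Gabriel filter of dense left ideals. -/
def denseLeft : LeftGabrielFilter R where
  sets := {I | ∀ y x : R, x ≠ 0 → ∃ r, r * y ∈ I ∧ r * x ≠ 0}
  top_mem y x hx := ⟨1, trivial, by simpa⟩
  mono I hI J h y x hx :=
    let ⟨r, h1, h2⟩ := hI y x hx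
    ⟨r, h h1, h2⟩
  inf_mem I hI J hJ y x hx := by
    obtain ⟨r, h1, h2⟩ := hI y x hx
    obtain ⟨s, h3, h4⟩ := hJ (r * y) (r * x) h2
    exact ⟨s * r, ⟨by rw [mul_assoc]; exact I.mul_mem_left s h1, by rwa [mul_assoc]⟩,
      by rwa [mul_assoc]⟩
  colon_mem I hI a y x hx := by
    obtain ⟨r, h1, h2⟩ := hI (y * a) x hx
    exact ⟨r, by rwa [mem_leftColon, mul_assoc], h2⟩
  mem_of_colon I hI J h y x hx := by
    obtain ⟨r, h1, h2⟩ := hI y x hx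
    obtain ⟨s, h3, h4⟩ := h (r * y) h1 1 (r * x) h2
    refine ⟨s * r, ?_, by rwa [mul_assoc]⟩
    rw [mul_one, mem_leftColon] at h3
    rwa [mul_assoc]

/-- The Gabriel filter of dense right ideals. -/
def denseRight : RightGabrielFilter R where
  sets := {I | ∀ y x : R, x ≠ 0 → ∃ r, y * r ∈ I ∧ x * r ≠ 0}
  top_mem y x hx := ⟨1, trivial, by simpa⟩
  mono I hI J h y x hx :=
    let ⟨r, h1, h2⟩ := hI y x hx
    ⟨r, h h1, h2⟩
  inf_mem I hI J hJ y x hx := by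
    obtain ⟨r, h1, h2⟩ := hI y x hx
    obtain ⟨s, h3, h4⟩ := hJ (y * r) (x * r) h2
    exact ⟨r * s, ⟨by rw [← mul_assoc]; exact RightIdeal.mul_mem I h1 s, by rwa [← mul_assoc]⟩,
      by rwa [← mul_assoc]⟩
  colon_mem I hI a y x hx := by
    obtain ⟨r, h1, h2⟩ := hI (a * y) x hx
    exact ⟨r, by rwa [mem_rightColon, ← mul_assoc], h2⟩
  mem_of_colon I hI J h y x hx := by
    obtain ⟨r, h1, h2⟩ := hI y x hx
    obtain ⟨s, h3, h4⟩ := h (y * r) h1 1 (x * r) h2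
    refine ⟨r * s, ?_, by rwa [← mul_assoc]⟩
    rw [one_mul, mem_rightColon] at h3
    rwa [← mul_assoc]

/-- The maximal symmetric ring of quotients. -/
abbrev MaximalSymmetric : Type u := SymmetricQuotient (denseLeft R) (denseRight R)

/-- The canonical map to the maximal symmetric ring of quotients. -/
noncomputable abbrev toMaximal : R →+* MaximalSymmetric R :=
  canonicalMap (denseLeft R) (denseRight R)

/-- The subrings of the maximal symmetric ring of quotients which contain the image of `R` and are
perfect symmetric rings of quotients of `R`. -/
def perfectSubrings : Set (Subring (MaximalSymmetric R)) :=
  {S | ∃ h : ∀ r : R, toMaximal R r ∈ S, IsPerfectSymmetric ((toMaximal R).codRestrict S h)}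

/-- The total symmetric ring of quotients, the largest perfect symmetric ring of quotients inside
the maximal symmetric ring of quotients, written as the join of all of them. -/
noncomputable def totalSymmetric : Subring (MaximalSymmetric R) := sSup (perfectSubrings R)

/-- If there is a largest perfect symmetric ring of quotients, it is `totalSymmetric R`. -/
theorem eq_totalSymmetric {T : Subring (MaximalSymmetric R)}
    (hT : IsGreatest (perfectSubrings R) T) : T = totalSymmetric R :=
  hT.isLUB.sSup_eq.symm

end Total

end SymQuot

namespace SymQuot

/-! ### Symmetric filters are differential -/

section Differential

variable {R : Type u} [Ring R]

theorem exists_left_mul_mem (Fl : LeftGabrielFilter R) {I : Ideal R} (hI : I ∈ Fl.sets)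
    {K : RightIdeal (Env R)} (hK : ∀ i ∈ I, (1 : R) ⊗ₜ[ℤ] MulOpposite.op i ∈ K) (t : Env R) :
    ∃ C ∈ Fl.sets, ∀ c ∈ C, t * ((1 : R) ⊗ₜ[ℤ] MulOpposite.op c) ∈ K := by
  induction t using TensorProduct.induction_on with
  | zero => exact ⟨⊤, Fl.top_mem, fun c _ => by rw [zero_mul]; exact K.zero_mem⟩
  | add a b ha hb =>
    obtain ⟨C, hC, h⟩ := ha
    obtain ⟨C', hC', h'⟩ := hb
    exact ⟨C ⊓ C', Fl.inf_mem _ hC _ hC', fun c hc => by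
      rw [add_mul]; exact K.add_mem (h c hc.1) (h' c hc.2)⟩
  | tmul r s =>
    refine ⟨leftColon I s.unop, Fl.colon_mem I hI _, fun c hc => ?_⟩
    simpa using RightIdeal.mul_mem K (hK _ hc) (r ⊗ₜ[ℤ] (1 : Rᵐᵒᵖ))

theorem exists_right_mul_mem (Fr : RightGabrielFilter R) {J : RightIdeal R} (hJ : J ∈ Fr.sets)
    {K : RightIdeal (Env R)} (hK : ∀ j ∈ J, j ⊗ₜ[ℤ] (1 : Rᵐᵒᵖ) ∈ K) (t : Env R) :
    ∃ C ∈ Fr.sets, ∀ c ∈ C, t * (c ⊗ₜ[ℤ] (1 : Rᵐᵒᵖ)) ∈ K := by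
  induction t using TensorProduct.induction_on with
  | zero => exact ⟨⊤, Fr.top_mem, fun c _ => by rw [zero_mul]; exact K.zero_mem⟩
  | add a b ha hb =>
    obtain ⟨C, hC, h⟩ := ha
    obtain ⟨C', hC', h'⟩ := hb
    exact ⟨C ⊓ C', Fr.inf_mem _ hC _ hC', fun c hc => by
      rw [add_mul]; exact K.add_mem (h c hc.1) (h' c hc.2)⟩
  | tmul r s =>
    refine ⟨rightColon J r, Fr.colon_mem J hJ _, fun c hc => ?_⟩
    simpa using RightIdeal.mul_mem K (hK _ hc) ((1 : R) ⊗ₜ[ℤ] s)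

/-- The right ideal of the elements of `K` which a derivation sends to `K`. -/
def derivationPreimage {A : Type u} [Ring A] (D : RingDerivation A) (K : RightIdeal A) :
    RightIdeal A where
  carrier := {x | x ∈ K ∧ D x ∈ K}
  zero_mem' := ⟨K.zero_mem, by
    rw [show D 0 = 0 from map_zero D.toAddMonoidHom]; exact K.zero_mem⟩
  add_mem' := by
    rintro x y ⟨hx, hx'⟩ ⟨hy, hy'⟩
    refine ⟨K.add_mem hx hy, ?_⟩
    rw [show D (x + y) = D x + D y from map_add D.toAddMonoidHom x y]
    exact K.add_mem hx' hy'
  smul_mem' := by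
    rintro c x ⟨hx, hx'⟩
    refine ⟨K.smul_mem c hx, ?_⟩
    rw [MulOpposite.smul_eq_mul_unop, D.leibniz]
    exact K.add_mem (RightIdeal.mul_mem K hx' _) (RightIdeal.mul_mem K hx _)

theorem isDifferential_symmetricFilter (Fl : LeftGabrielFilter R) (Fr : RightGabrielFilter R) :
    IsDifferential (symmetricFilter Fl Fr) := by
  rintro D K ⟨I, hI, J, hJ, hIJ⟩
  rw [inducedIdeal_le] at hIJ
  let L := derivationPreimage D K
  let I' : Ideal R :=
    { carrier := {x | (1 : R) ⊗ₜ[ℤ] MulOpposite.op x ∈ L}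
      zero_mem' := by
        rw [Set.mem_ofPred_eq, MulOpposite.op_zero, TensorProduct.tmul_zero]; exact L.zero_mem
      add_mem' := by
        intro x y hx hy
        rw [Set.mem_ofPred_eq, MulOpposite.op_add, TensorProduct.tmul_add]
        exact L.add_mem hx hy
      smul_mem' := by
        intro c x hx
        simpa using RightIdeal.mul_mem L hx ((1 : R) ⊗ₜ[ℤ] MulOpposite.op c) }
  let J' : RightIdeal R :=
    { carrier := {x | x ⊗ₜ[ℤ] (1 : Rᵐᵒᵖ) ∈ L}
      zero_mem' := by
        rw [Set.mem_ofPred_eq, TensorProduct.zero_tmul]; exact L.zero_mem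
      add_mem' := by
        intro x y hx hy
        rw [Set.mem_ofPred_eq, TensorProduct.add_tmul]
        exact L.add_mem hx hy
      smul_mem' := by
        intro c x hx
        simpa using RightIdeal.mul_mem L hx (c.unop ⊗ₜ[ℤ] (1 : Rᵐᵒᵖ)) }
  refine ⟨L, ⟨I', left_dense Fl hI fun a ha => ?_, J', right_dense Fr hJ fun a ha => ?_,
    inducedIdeal_le.2 ⟨fun j hj => hj, fun i hi => hi⟩⟩, fun x hx => hx.2⟩
  · obtain ⟨C, hC, h⟩ := exists_left_mul_mem Fl hI hIJ.2 (D (1 ⊗ₜ[ℤ] MulOpposite.op a))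
    refine ⟨C, hC, fun c hc => ⟨hIJ.2 _ (I.mul_mem_left c ha), ?_⟩⟩
    rw [show (1 : R) ⊗ₜ[ℤ] MulOpposite.op (c * a) =
      (1 ⊗ₜ[ℤ] MulOpposite.op a) * (1 ⊗ₜ[ℤ] MulOpposite.op c) by simp, D.leibniz]
    exact K.add_mem (h c hc) (RightIdeal.mul_mem K (hIJ.2 a ha) _)
  · obtain ⟨C, hC, h⟩ := exists_right_mul_mem Fr hJ hIJ.1 (D (a ⊗ₜ[ℤ] 1))
    refine ⟨C, hC, fun c hc => ⟨hIJ.1 _ (RightIdeal.mul_mem J ha c), ?_⟩⟩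
    rw [show (a * c) ⊗ₜ[ℤ] (1 : Rᵐᵒᵖ) = (a ⊗ₜ[ℤ] 1) * (c ⊗ₜ[ℤ] 1) by simp, D.leibniz]
    exact K.add_mem (h c hc) (RightIdeal.mul_mem K (hIJ.1 a ha) _)

end Differential

/-! ### Ideals that generate the unit ideal of an overring -/

section Full

variable {R : Type u} [Ring R] {S : Type v} [Ring S] (f : R →+* S)

/-- The left ideal `I` generates `S` as a left ideal. -/
def LeftFull (I : Ideal R) : Prop := Submodule.span S (f '' (I : Set R)) = ⊤

/-- The right ideal `J` generates `S` as a right ideal. -/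
def RightFull (J : RightIdeal R) : Prop := Submodule.span Sᵐᵒᵖ (f '' (J : Set R)) = ⊤

/-- The left ideal of the `r` with `f r * s` in the image of `f`. -/
def leftDen (s : S) : Ideal R where
  carrier := {r | ∃ a, f a = f r * s}
  zero_mem' := ⟨0, by simp⟩
  add_mem' := by
    rintro x y ⟨a, ha⟩ ⟨b, hb⟩
    exact ⟨a + b, by rw [map_add, map_add, ha, hb, add_mul]⟩
  smul_mem' := by
    rintro c x ⟨a, ha⟩
    exact ⟨c * a, by rw [smul_eq_mul, map_mul, map_mul, ha, mul_assoc]⟩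

/-- The right ideal of the `r` with `s * f r` in the image of `f`. -/
def rightDen (s : S) : RightIdeal R where
  carrier := {r | ∃ a, f a = s * f r}
  zero_mem' := ⟨0, by simp⟩
  add_mem' := by
    rintro x y ⟨a, ha⟩ ⟨b, hb⟩
    exact ⟨a + b, by rw [map_add, map_add, ha, hb, mul_add]⟩
  smul_mem' := by
    rintro c x ⟨a, ha⟩
    exact ⟨a * c.unop, by
      rw [MulOpposite.smul_eq_mul_unop, map_mul, map_mul, ha, mul_assoc]⟩

/-- Every element of `S` has left and right denominators in `R` that generate `S`. -/
def HasDenominators : Prop :=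
  ∀ s : S, LeftFull f (leftDen f s) ∧ RightFull f (rightDen f s)

variable {f}

theorem leftFull_of_le {I : Ideal R} {N : Ideal S} (hI : LeftFull f I) (h : ∀ i ∈ I, f i ∈ N)
    (x : S) : x ∈ N :=
  Submodule.span_le.2 (Set.image_subset_iff.2 h) (hI.symm ▸ Submodule.mem_top : x ∈ _)

theorem rightFull_of_le {J : RightIdeal R} {N : RightIdeal S} (hJ : RightFull f J)
    (h : ∀ j ∈ J, f j ∈ N) (x : S) : x ∈ N :=
  Submodule.span_le.2 (Set.image_subset_iff.2 h) (hJ.symm ▸ Submodule.mem_top : x ∈ _)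

theorem LeftFull.mono {I I' : Ideal R} (hI : LeftFull f I) (h : I ≤ I') : LeftFull f I' :=
  top_le_iff.1 (hI.symm.trans_le (Submodule.span_mono (Set.image_mono h)))

theorem RightFull.mono {J J' : RightIdeal R} (hJ : RightFull f J) (h : J ≤ J') : RightFull f J' :=
  top_le_iff.1 (hJ.symm.trans_le (Submodule.span_mono (Set.image_mono h)))

theorem leftFull_top : LeftFull f ⊤ :=
  (Ideal.eq_top_iff_one _).2 (Submodule.subset_span ⟨1, trivial, map_one f⟩)

theorem rightFull_top : RightFull f ⊤ :=
  Submodule.eq_top_iff'.2 fun x => by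
    simpa using (Submodule.span Sᵐᵒᵖ (f '' ((⊤ : RightIdeal R) : Set R))).smul_mem
      (MulOpposite.op x) (Submodule.subset_span ⟨1, trivial, map_one f⟩)

theorem LeftFull.eq_zero {I : Ideal R} (hI : LeftFull f I) {x : S} (h : ∀ i ∈ I, f i * x = 0) :
    x = 0 := by
  exact (one_mul x).symm.trans (leftFull_of_le (N := annL x) hI h 1)

theorem RightFull.eq_zero {J : RightIdeal R} (hJ : RightFull f J) {x : S}
    (h : ∀ j ∈ J, x * f j = 0) : x = 0 := by
  exact (mul_one x).symm.trans (rightFull_of_le (N := annR x) hJ h 1)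

theorem LeftFull.of_colon {I J : Ideal R} (hI : LeftFull f I)
    (h : ∀ a ∈ I, LeftFull f (leftColon J a)) : LeftFull f J := by
  refine Submodule.eq_top_iff'.2 (leftFull_of_le hI fun a ha => ?_)
  have := leftFull_of_le (N := leftColon (Submodule.span S (f '' (J : Set R))) (f a)) (h a ha)
    (fun i hi => by
      rw [mem_leftColon, ← map_mul]
      exact Submodule.subset_span ⟨_, hi, rfl⟩) 1
  rwa [mem_leftColon, one_mul] at this

theorem RightFull.of_colon {I J : RightIdeal R} (hI : RightFull f I)
    (h : ∀ a ∈ I, RightFull f (rightColon J a)) : RightFull f J := by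
  refine Submodule.eq_top_iff'.2 (rightFull_of_le hI fun a ha => ?_)
  have := rightFull_of_le (N := rightColon (Submodule.span Sᵐᵒᵖ (f '' (J : Set R))) (f a)) (h a ha)
    (fun i hi => by
      rw [mem_rightColon, ← map_mul]
      exact Submodule.subset_span ⟨_, hi, rfl⟩) 1
  rwa [mem_rightColon, mul_one] at this

theorem LeftFull.map {T : Type w} [Ring T] {I : Ideal R} (hI : LeftFull f I) (ι : S →+* T) :
    LeftFull (ι.comp f) I := by
  let M : Ideal T := Submodule.span T (ι.comp f '' (I : Set R))
  have h1 := leftFull_of_le (N := Ideal.comap ι M) hI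
    (fun i hi => Ideal.mem_comap.2 (Submodule.subset_span ⟨i, hi, rfl⟩)) 1
  rw [Ideal.mem_comap, map_one] at h1
  exact (Ideal.eq_top_iff_one M).2 h1

theorem RightFull.map {T : Type w} [Ring T] {J : RightIdeal R} (hJ : RightFull f J)
    (ι : S →+* T) : RightFull (ι.comp f) J := by
  let M := Submodule.span Tᵐᵒᵖ (ι.comp f '' (J : Set R))
  let N : RightIdeal S :=
    { carrier := {x | ι x ∈ M}
      zero_mem' := by simp
      add_mem' := by
        intro x y hx hy
        rw [Set.mem_ofPred_eq, map_add]; exact M.add_mem hx hy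
      smul_mem' := by
        intro c x hx
        rw [Set.mem_ofPred_eq, MulOpposite.smul_eq_mul_unop, map_mul]
        exact RightIdeal.mul_mem M hx _ }
  have h1 : ι 1 ∈ M := rightFull_of_le (N := N) hJ
    (fun i hi => (Submodule.subset_span ⟨i, hi, rfl⟩ : ι (f i) ∈ M)) 1
  rw [map_one] at h1
  exact Submodule.eq_top_iff'.2 fun x =>
    one_mul x ▸ RightIdeal.mul_mem M h1 x

theorem HasDenominators.leftFull_colon (hf : HasDenominators f) (inj : Function.Injective f)
    {I : Ideal R} (hI : LeftFull f I) (a : R) : LeftFull f (leftColon I a) := by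
  let P : S → Ideal R := fun x =>
    { carrier := {r | ∃ i ∈ I, f i = f r * x}
      zero_mem' := ⟨0, I.zero_mem, by simp⟩
      add_mem' := by
        rintro r r' ⟨b, hb, h⟩ ⟨b', hb', h'⟩
        exact ⟨b + b', I.add_mem hb hb', by rw [map_add, map_add, h, h', add_mul]⟩
      smul_mem' := by
        rintro c r ⟨b, hb, h⟩
        exact ⟨c * b, I.mul_mem_left c hb, by
          rw [smul_eq_mul, map_mul, map_mul, h, mul_assoc]⟩ }
  let N : Ideal S :=
    { carrier := {x | ∀ s, LeftFull f (P (s * x))}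
      zero_mem' := fun s => leftFull_top.mono fun r _ => ⟨0, I.zero_mem, by simp⟩
      add_mem' := by
        intro x y hx hy s
        refine (hx s).of_colon fun r hr => (hy (f r * s)).mono ?_
        obtain ⟨b, hb, h⟩ := hr
        rintro r' ⟨b', hb', h'⟩
        refine ⟨r' * b + b', I.add_mem (I.mul_mem_left _ hb) hb', ?_⟩
        rw [map_add, map_mul, h, h', map_mul]
        simp only [mul_add, mul_assoc]
      smul_mem' := by
        intro c x hx s
        rw [smul_eq_mul, ← mul_assoc]
        exact hx _ }
  have key := leftFull_of_le (N := N) hI (fun i hi s => (hf s).1.mono fun r hr => by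
    obtain ⟨b, h⟩ := hr
    exact ⟨b * i, I.mul_mem_left b hi, by rw [map_mul, h, mul_assoc]⟩) (f a) 1
  refine key.mono fun r hr => ?_
  obtain ⟨i, hi, h⟩ := hr
  rw [one_mul, ← map_mul] at h
  rw [mem_leftColon, ← inj h]
  exact hi

theorem HasDenominators.rightFull_colon (hf : HasDenominators f) (inj : Function.Injective f)
    {J : RightIdeal R} (hJ : RightFull f J) (a : R) : RightFull f (rightColon J a) := by
  let P : S → RightIdeal R := fun x =>
    { carrier := {r | ∃ i ∈ J, f i = x * f r}
      zero_mem' := ⟨0, J.zero_mem, by simp⟩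
      add_mem' := by
        rintro r r' ⟨b, hb, h⟩ ⟨b', hb', h'⟩
        exact ⟨b + b', J.add_mem hb hb', by rw [map_add, map_add, h, h', mul_add]⟩
      smul_mem' := by
        rintro c r ⟨b, hb, h⟩
        exact ⟨b * c.unop, RightIdeal.mul_mem J hb _, by
          rw [MulOpposite.smul_eq_mul_unop, map_mul, map_mul, h, mul_assoc]⟩ }
  let N : RightIdeal S :=
    { carrier := {x | ∀ s, RightFull f (P (x * s))}
      zero_mem' := fun s => rightFull_top.mono fun r _ => ⟨0, J.zero_mem, by simp⟩
      add_mem' := by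
        intro x y hx hy s
        refine (hx s).of_colon fun r hr => (hy (s * f r)).mono ?_
        obtain ⟨b, hb, h⟩ := hr
        rintro r' ⟨b', hb', h'⟩
        refine ⟨b * r' + b', J.add_mem (RightIdeal.mul_mem J hb _) hb', ?_⟩
        rw [map_add, map_mul, h, h', map_mul]
        simp only [add_mul, mul_assoc]
      smul_mem' := by
        intro c x hx s
        rw [MulOpposite.smul_eq_mul_unop, mul_assoc]
        exact hx _ }
  have key := rightFull_of_le (N := N) hJ (fun i hi s => (hf s).2.mono fun r hr => by
    obtain ⟨b, h⟩ := hr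
    exact ⟨i * b, RightIdeal.mul_mem J hi b, by rw [map_mul, h, mul_assoc]⟩) (f a) 1
  refine key.mono fun r hr => ?_
  obtain ⟨i, hi, h⟩ := hr
  rw [mul_one, ← map_mul] at h
  rw [mem_rightColon, ← inj h]
  exact hi

variable (f) in
/-- The Gabriel filter of the left ideals that generate `S`. -/
def leftFilter (hf : HasDenominators f) (inj : Function.Injective f) : LeftGabrielFilter R where
  sets := {I | LeftFull f I}
  top_mem := leftFull_top
  mono _ hI _ h := hI.mono h
  inf_mem I hI _ hJ := LeftFull.of_colon hI fun a ha =>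
    (hf.leftFull_colon inj hJ a).mono fun _ hr => ⟨I.mul_mem_left _ ha, hr⟩
  colon_mem _ hI a := hf.leftFull_colon inj hI a
  mem_of_colon _ hI _ h := LeftFull.of_colon hI h

variable (f) in
/-- The Gabriel filter of the right ideals that generate `S`. -/
def rightFilter (hf : HasDenominators f) (inj : Function.Injective f) : RightGabrielFilter R where
  sets := {J | RightFull f J}
  top_mem := rightFull_top
  mono _ hI _ h := hI.mono h
  inf_mem I hI _ hJ := RightFull.of_colon hI fun a ha =>
    (hf.rightFull_colon inj hJ a).mono fun _ hr => ⟨RightIdeal.mul_mem I ha _, hr⟩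
  colon_mem _ hI a := hf.rightFull_colon inj hI a
  mem_of_colon _ hI _ h := RightFull.of_colon hI h

/-- Compatible functions on a full left and a full right ideal are multiplications by a common
element. -/
theorem exists_mul_eq_of_full {I : Ideal R} {J : RightIdeal R} (hI : LeftFull f I)
    (hJ : RightFull f J) {F G : R → S} (h : ∀ i ∈ I, ∀ j ∈ J, F i * f j = f i * G j) :
    ∃ q, (∀ i ∈ I, f i * q = F i) ∧ ∀ j ∈ J, q * f j = G j := by
  -- the `x` such that `j ↦ x * G j` is a left multiplication
  let N : Ideal S :=
    { carrier := {x | ∃ q, ∀ j ∈ J, q * f j = x * G j}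
      zero_mem' := ⟨0, by simp⟩
      add_mem' := by
        rintro x y ⟨p, hp⟩ ⟨q, hq⟩
        exact ⟨p + q, fun j hj => by rw [add_mul, add_mul, hp j hj, hq j hj]⟩
      smul_mem' := by
        rintro c x ⟨p, hp⟩
        exact ⟨c * p, fun j hj => by rw [smul_eq_mul, mul_assoc, mul_assoc, hp j hj]⟩ }
  obtain ⟨q, hq⟩ := leftFull_of_le (N := N) hI (fun i hi => ⟨F i, fun j hj => h i hi j hj⟩) 1
  simp only [one_mul] at hq
  refine ⟨q, fun i hi => ?_, hq⟩
  refine sub_eq_zero.1 (hJ.eq_zero fun j hj => ?_)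
  rw [sub_mul, mul_assoc, hq j hj, h i hi j hj, sub_self]

variable (f) in
/-- The elements of `S` whose left and right multiples by `R` all have denominators. -/
def denSubring : Subring S where
  carrier := {x | ∀ a, LeftFull f (leftDen f (f a * x)) ∧ RightFull f (rightDen f (x * f a))}
  one_mem' a := ⟨leftFull_top.mono fun r _ => ⟨r * a, by simp⟩,
    rightFull_top.mono fun r _ => ⟨a * r, by simp⟩⟩
  zero_mem' a := ⟨leftFull_top.mono fun r _ => ⟨0, by simp⟩,
    rightFull_top.mono fun r _ => ⟨0, by simp⟩⟩
  neg_mem' := by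
    intro x hx a
    refine ⟨(hx a).1.mono ?_, (hx a).2.mono ?_⟩
    · rintro r ⟨b, hb⟩
      exact ⟨-b, by rw [map_neg, hb]; simp⟩
    · rintro r ⟨b, hb⟩
      exact ⟨-b, by rw [map_neg, hb]; simp⟩
  add_mem' := by
    intro x y hx hy a
    constructor
    · refine (hx a).1.of_colon fun r hr => (hy (r * a)).1.mono ?_
      obtain ⟨b, hb⟩ := hr
      rintro r' ⟨c, hc⟩
      refine ⟨r' * b + c, ?_⟩
      rw [map_add, map_mul, hb, hc, map_mul, map_mul]
      simp only [mul_add, mul_assoc]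
    · refine (hx a).2.of_colon fun r hr => (hy (a * r)).2.mono ?_
      obtain ⟨b, hb⟩ := hr
      rintro r' ⟨c, hc⟩
      refine ⟨b * r' + c, ?_⟩
      rw [map_add, map_mul, hb, hc, map_mul, map_mul]
      simp only [add_mul, mul_assoc]
  mul_mem' := by
    intro x y hx hy a
    constructor
    · refine (hx a).1.of_colon fun r hr => ?_
      obtain ⟨b, hb⟩ := hr
      refine (hy b).1.mono ?_
      rintro r' ⟨c, hc⟩
      exact ⟨c, by rw [hc, hb, map_mul]; simp only [mul_assoc]⟩
    · refine (hy a).2.of_colon fun r hr => ?_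
      obtain ⟨b, hb⟩ := hr
      refine (hx b).2.mono ?_
      rintro r' ⟨c, hc⟩
      exact ⟨c, by rw [hc, hb, map_mul]; simp only [mul_assoc]⟩

theorem HasDenominators.map_mem_denSubring (hf : HasDenominators f) {T : Type w} [Ring T]
    (ι : S →+* T) (s : S) : ι s ∈ denSubring (ι.comp f) := by
  refine fun a => ⟨((hf (f a * s)).1.map ι).mono ?_, ((hf (s * f a)).2.map ι).mono ?_⟩
  · rintro r ⟨b, hb⟩
    exact ⟨b, by simp [hb]⟩
  · rintro r ⟨b, hb⟩
    exact ⟨b, by simp [hb]⟩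

theorem hasDenominators_of_denSubring_eq_top (h : denSubring f = ⊤) : HasDenominators f := by
  intro s
  have hs : s ∈ denSubring f := h ▸ Subring.mem_top s
  have := hs 1
  rwa [map_one, one_mul, mul_one] at this

end Full
/-! ### Perfectness in terms of denominators -/

section Criterion

variable {R : Type u} [Ring R] {S : Type v} [Ring S] {f : R →+* S}

theorem IsPerfectWith.hasDenominators {Fl : LeftGabrielFilter R} {Fr : RightGabrielFilter R}
    (h : IsPerfectWith f Fl Fr) : HasDenominators f := by
  obtain ⟨g, hg⟩ := h.iso
  have hp : ∀ r, quotientRingEquiv Fl Fr (g (f r)) = toPair Fl Fr r := fun r => by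
    rw [hg, quotientRingEquiv_canonicalMap]
  have inj : Function.Injective fun s => quotientRingEquiv Fl Fr (g s) :=
    (quotientRingEquiv Fl Fr).injective.comp g.injective
  intro s
  obtain ⟨⟨I, hI, hIp⟩, ⟨J, hJ, hJp⟩⟩ := pair_exists (quotientRingEquiv Fl Fr (g s))
  refine ⟨LeftFull.mono ((h.left I).1 hI) fun i hi => ?_,
    RightFull.mono ((h.right J).1 hJ) fun j hj => ?_⟩
  · obtain ⟨a, ha⟩ := hIp i hi
    obtain ⟨b, rfl⟩ := Ideal.Quotient.mk_surjective a
    refine ⟨b, inj ?_⟩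
    change quotientRingEquiv Fl Fr (g (f b)) = quotientRingEquiv Fl Fr (g (f i * s))
    rw [map_mul, map_mul, hp, hp]
    exact ha
  · obtain ⟨a, ha⟩ := hJp j hj
    obtain ⟨b, rfl⟩ := Ideal.Quotient.mk_surjective a
    refine ⟨b, inj ?_⟩
    change quotientRingEquiv Fl Fr (g (f b)) = quotientRingEquiv Fl Fr (g (s * f j))
    rw [map_mul, map_mul, hp, hp]
    exact ha

variable (f)

/-- The pairs of elements with common denominators and numerators. -/
def commonFractions (Fl : LeftGabrielFilter R) (Fr : RightGabrielFilter R) :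
    Subring (S × PairRing Fl Fr) where
  carrier := {x | (∃ I ∈ Fl.sets, ∀ i ∈ I, ∃ a, f a = f i * x.1 ∧
      toPair Fl Fr a = toPair Fl Fr i * x.2) ∧
    ∃ J ∈ Fr.sets, ∀ j ∈ J, ∃ a, f a = x.1 * f j ∧ toPair Fl Fr a = x.2 * toPair Fl Fr j}
  one_mem' := ⟨⟨⊤, Fl.top_mem, fun i _ => ⟨i, (mul_one _).symm, (mul_one _).symm⟩⟩,
    ⟨⊤, Fr.top_mem, fun i _ => ⟨i, (one_mul _).symm, (one_mul _).symm⟩⟩⟩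
  zero_mem' := ⟨⟨⊤, Fl.top_mem, fun i _ => ⟨0, by simp, by simp⟩⟩,
    ⟨⊤, Fr.top_mem, fun i _ => ⟨0, by simp, by simp⟩⟩⟩
  neg_mem' := by
    rintro x ⟨⟨I, hI, h⟩, ⟨J, hJ, h'⟩⟩
    refine ⟨⟨I, hI, fun i hi => ?_⟩, ⟨J, hJ, fun j hj => ?_⟩⟩
    · obtain ⟨a, ha, ha'⟩ := h i hi
      exact ⟨-a, by rw [map_neg, ha, Prod.fst_neg, mul_neg],
        by rw [map_neg, ha', Prod.snd_neg, mul_neg]⟩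
    · obtain ⟨a, ha, ha'⟩ := h' j hj
      exact ⟨-a, by rw [map_neg, ha, Prod.fst_neg, neg_mul],
        by rw [map_neg, ha', Prod.snd_neg, neg_mul]⟩
  add_mem' := by
    rintro x y ⟨⟨I, hI, h⟩, ⟨J, hJ, h'⟩⟩ ⟨⟨I', hI', k⟩, ⟨J', hJ', k'⟩⟩
    refine ⟨⟨I ⊓ I', Fl.inf_mem _ hI _ hI', fun i hi => ?_⟩,
      ⟨J ⊓ J', Fr.inf_mem _ hJ _ hJ', fun j hj => ?_⟩⟩
    · obtain ⟨a, ha, ha'⟩ := h i hi.1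
      obtain ⟨b, hb, hb'⟩ := k i hi.2
      exact ⟨a + b, by rw [map_add, ha, hb, Prod.fst_add, mul_add],
        by rw [map_add, ha', hb', Prod.snd_add, mul_add]⟩
    · obtain ⟨a, ha, ha'⟩ := h' j hj.1
      obtain ⟨b, hb, hb'⟩ := k' j hj.2
      exact ⟨a + b, by rw [map_add, ha, hb, Prod.fst_add, add_mul],
        by rw [map_add, ha', hb', Prod.snd_add, add_mul]⟩
  mul_mem' := by
    rintro x y ⟨⟨I, hI, h⟩, ⟨J, hJ, h'⟩⟩ ⟨⟨I', hI', k⟩, ⟨J', hJ', k'⟩⟩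
    constructor
    · let D : Ideal R :=
        { carrier := {i | ∃ a, f a = f i * (x.1 * y.1) ∧
            toPair Fl Fr a = toPair Fl Fr i * (x.2 * y.2)}
          zero_mem' := ⟨0, by simp, by simp⟩
          add_mem' := by
            rintro i j ⟨a, ha, ha'⟩ ⟨b, hb, hb'⟩
            exact ⟨a + b, by rw [map_add, ha, hb, map_add, add_mul],
              by rw [map_add, ha', hb', map_add, add_mul]⟩
          smul_mem' := by
            rintro c i ⟨a, ha, ha'⟩
            exact ⟨c * a, by rw [map_mul, ha, smul_eq_mul, map_mul, mul_assoc],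
              by rw [map_mul, ha', smul_eq_mul, map_mul, mul_assoc]⟩ }
      refine ⟨D, left_dense Fl hI fun i hi => ?_, fun i hi => hi⟩
      obtain ⟨a, ha, ha'⟩ := h i hi
      refine ⟨leftColon I' a, Fl.colon_mem I' hI' a, fun c hc => ?_⟩
      obtain ⟨b, hb, hb'⟩ := k _ hc
      refine ⟨b, ?_, ?_⟩
      · rw [hb, map_mul, ha, map_mul]; simp only [mul_assoc]
      · rw [hb', map_mul, ha', map_mul]; simp only [mul_assoc]
    · let D : RightIdeal R :=
        { carrier := {i | ∃ a, f a = x.1 * y.1 * f i ∧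
            toPair Fl Fr a = x.2 * y.2 * toPair Fl Fr i}
          zero_mem' := ⟨0, by simp, by simp⟩
          add_mem' := by
            rintro i j ⟨a, ha, ha'⟩ ⟨b, hb, hb'⟩
            exact ⟨a + b, by rw [map_add, ha, hb, map_add, mul_add],
              by rw [map_add, ha', hb', map_add, mul_add]⟩
          smul_mem' := by
            rintro c i ⟨a, ha, ha'⟩
            exact ⟨a * c.unop,
              by rw [map_mul, ha, MulOpposite.smul_eq_mul_unop, map_mul, mul_assoc],
              by rw [map_mul, ha', MulOpposite.smul_eq_mul_unop, map_mul, mul_assoc]⟩ }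
      refine ⟨D, right_dense Fr hJ' fun i hi => ?_, fun i hi => hi⟩
      obtain ⟨a, ha, ha'⟩ := k' i hi
      refine ⟨rightColon J a, Fr.colon_mem J hJ a, fun c hc => ?_⟩
      obtain ⟨b, hb, hb'⟩ := h' _ hc
      refine ⟨b, ?_, ?_⟩
      · rw [hb, map_mul, ha, map_mul]; simp only [mul_assoc]
      · rw [hb', map_mul, ha', map_mul]; simp only [mul_assoc]

variable {f} (hf : HasDenominators f) (inj : Function.Injective f)


theorem toPair_eq_zero {x : R} :
    toPair (leftFilter f hf inj) (rightFilter f hf inj) x = 0 ↔ x = 0 := by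
  refine ⟨fun h => ?_, fun h => by rw [h, map_zero]⟩
  have h0 : toFree _ _ x = 0 := pairOf_injective (h.trans (map_zero _).symm)
  rw [Ideal.Quotient.eq_zero_iff_mem, mem_torsionIdeal] at h0
  obtain ⟨⟨I, hI, h⟩, -⟩ := h0
  refine inj ?_
  rw [map_zero]
  exact LeftFull.eq_zero hI fun i hi => by rw [← map_mul, h i hi, map_zero]

theorem toPair_injective :
    Function.Injective (toPair (leftFilter f hf inj) (rightFilter f hf inj)) :=
  (injective_iff_map_eq_zero _).2 fun _ => (toPair_eq_zero hf inj).1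

/-- Multiplication by `s` as a partial homomorphism. -/
noncomputable def multiplicationHom (s : S) :
    PartialHom (leftFilter f hf inj) (rightFilter f hf inj) where
  dom :=
    { carrier := {k | ∃ a, f a = biAct f s k}
      zero_mem' := ⟨0, by rw [map_zero, map_zero]⟩
      add_mem' := by
        rintro k l ⟨a, ha⟩ ⟨b, hb⟩
        exact ⟨a + b, by rw [map_add, map_add, ha, hb]⟩
      smul_mem' := by
        rintro t k ⟨a, ha⟩
        refine ⟨biAct (RingHom.id R) a t.unop, ?_⟩
        rw [MulOpposite.smul_eq_mul_unop, biAct_mul, ← ha, ← biAct_map]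
        rfl }
  dom_mem := ⟨_, (hf s).1, _, (hf s).2, inducedIdeal_le.2 ⟨fun j ⟨a, ha⟩ => ⟨a, by simpa using ha⟩,
    fun i ⟨a, ha⟩ => ⟨a, by simpa using ha⟩⟩⟩
  toHom := AddMonoidHom.mk' (fun k => toFree _ _ k.2.choose) fun k l => by
    rw [← map_add]
    refine congrArg _ (inj ?_)
    rw [map_add, (k + l).2.choose_spec, k.2.choose_spec, l.2.choose_spec, ← map_add]
    rfl
  map_mul k t := by
    refine Eq.trans (congrArg (toFree _ _) (inj ?_)) (biAct_map (RingHom.id R) (toFree _ _) _ t).symm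
    rw [(MulOpposite.op t • k).2.choose_spec, ← biAct_map, k.2.choose_spec]
    exact biAct_mul f s k t

theorem multiplicationHom_spec {s : S} {k : (multiplicationHom hf inj s).dom} {a : R}
    (h : f a = biAct f s k) : (multiplicationHom hf inj s).toHom k = toFree _ _ a :=
  congrArg _ (inj (k.2.choose_spec.trans h.symm))

theorem commonFractions_fst_bijective :
    Function.Bijective fun x :
      commonFractions f (leftFilter f hf inj) (rightFilter f hf inj) => x.1.1 := by
  constructor
  · rintro ⟨⟨s, p⟩, hx⟩ ⟨⟨s', p'⟩, hx'⟩ (h : s = s')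
    subst h
    have := Subring.sub_mem _ hx hx'
    obtain ⟨⟨I, hI, h1⟩, ⟨J, hJ, h2⟩⟩ := this
    refine Subtype.ext (Prod.ext rfl (sub_eq_zero.1 (pair_eq_zero ⟨I, hI, fun i hi => ?_⟩
      ⟨J, hJ, fun j hj => ?_⟩)))
    · obtain ⟨a, ha, ha'⟩ := h1 i hi
      have h0 : a = 0 := inj (by simpa using ha)
      rw [h0, map_zero] at ha'
      exact ha'.symm
    · obtain ⟨a, ha, ha'⟩ := h2 j hj
      have h0 : a = 0 := inj (by simpa using ha)
      rw [h0, map_zero] at ha'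
      exact ha'.symm
  · intro s
    obtain ⟨p, hp⟩ := ofPair_surjective (Quotient.mk _ (multiplicationHom hf inj s))
    obtain ⟨L, ⟨I, hI, J, hJ, hIJ⟩, h₁, h₂, h⟩ := Quotient.exact hp
    rw [inducedIdeal_le] at hIJ
    have key : ∀ x ∈ L, ∃ a, f a = biAct f s x ∧
        toPair _ _ a = biAct (toPair (leftFilter f hf inj) (rightFilter f hf inj)) p x := by
      intro x hx
      obtain ⟨a, ha⟩ := h₂ hx
      refine ⟨a, ha, ?_⟩
      rw [← pairHom_spec p ⟨x, h₁ hx⟩, h x hx, multiplicationHom_spec hf inj ha]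
      rfl
    refine ⟨⟨⟨s, p⟩, ⟨I, hI, fun i hi => ?_⟩, ⟨J, hJ, fun j hj => ?_⟩⟩, rfl⟩
    · simpa using key _ (hIJ.2 i hi)
    · simpa using key _ (hIJ.1 j hj)

theorem commonFractions_snd_bijective :
    Function.Bijective fun x :
      commonFractions f (leftFilter f hf inj) (rightFilter f hf inj) => x.1.2 := by
  constructor
  · rintro ⟨⟨s, p⟩, hx⟩ ⟨⟨s', p'⟩, hx'⟩ (h : p = p')
    subst h
    obtain ⟨⟨I, hI, h1⟩, -⟩ := Subring.sub_mem _ hx hx'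
    refine Subtype.ext (Prod.ext (sub_eq_zero.1 (LeftFull.eq_zero hI fun i hi => ?_)) rfl)
    obtain ⟨a, ha, ha'⟩ := h1 i hi
    have h0 : a = 0 := (toPair_eq_zero hf inj).1 (by simpa using ha')
    rw [h0, map_zero] at ha
    exact ha.symm
  · intro p
    obtain ⟨⟨I, hI, h1⟩, ⟨J, hJ, h2⟩⟩ := pair_exists p
    have h1' : ∀ i : I, ∃ a, toPair _ _ a = toPair _ _ i.1 * p := fun i => by
      obtain ⟨a, ha⟩ := h1 i i.2
      obtain ⟨b, rfl⟩ := Ideal.Quotient.mk_surjective a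
      exact ⟨b, ha⟩
    have h2' : ∀ j : J, ∃ a, toPair _ _ a = p * toPair _ _ j.1 := fun j => by
      obtain ⟨a, ha⟩ := h2 j j.2
      obtain ⟨b, rfl⟩ := Ideal.Quotient.mk_surjective a
      exact ⟨b, ha⟩
    choose F hF using h1'
    choose G hG using h2'
    obtain ⟨q, hq, hq'⟩ := exists_mul_eq_of_full (f := f) hI hJ
      (F := fun i => open Classical in if hi : i ∈ I then f (F ⟨i, hi⟩) else 0)
      (G := fun j => open Classical in if hj : j ∈ J then f (G ⟨j, hj⟩) else 0)
      (fun i hi j hj => by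
        rw [dif_pos hi, dif_pos hj, ← map_mul, ← map_mul]
        refine congrArg f (toPair_injective hf inj ?_)
        rw [map_mul, map_mul, hF, hG, mul_assoc])
    refine ⟨⟨⟨q, p⟩, ⟨I, hI, fun i hi => ⟨F ⟨i, hi⟩, ?_, hF _⟩⟩,
      ⟨J, hJ, fun j hj => ⟨G ⟨j, hj⟩, ?_, hG _⟩⟩⟩, rfl⟩
    · exact ((hq i hi).trans (dif_pos hi)).symm
    · exact ((hq' j hj).trans (dif_pos hj)).symm

theorem HasDenominators.isPerfectSymmetric (hf : HasDenominators f)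
    (inj : Function.Injective f) : IsPerfectSymmetric f := by
  refine ⟨leftFilter f hf inj, rightFilter f hf inj, fun _ => Iff.rfl, fun _ => Iff.rfl, ?_⟩
  let C := commonFractions f (leftFilter f hf inj) (rightFilter f hf inj)
  let e₁ : C ≃+* S := RingEquiv.ofBijective ((RingHom.fst _ _).comp C.subtype)
    (commonFractions_fst_bijective hf inj)
  let e₂ : C ≃+* PairRing (leftFilter f hf inj) (rightFilter f hf inj) :=
    RingEquiv.ofBijective ((RingHom.snd _ _).comp C.subtype)
      (commonFractions_snd_bijective hf inj)
  refine ⟨(e₁.symm.trans e₂).trans (quotientRingEquiv _ _).symm, fun r => ?_⟩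
  have hr : (f r, toPair _ _ r) ∈ C :=
    ⟨⟨⊤, leftFull_top, fun i _ => ⟨i * r, map_mul _ _ _, map_mul _ _ _⟩⟩,
      ⟨⊤, rightFull_top, fun i _ => ⟨r * i, map_mul _ _ _, map_mul _ _ _⟩⟩⟩
  have h1 : e₁.symm (f r) = ⟨_, hr⟩ := (RingEquiv.symm_apply_eq e₁).2 rfl
  rw [RingEquiv.trans_apply, RingEquiv.trans_apply, RingEquiv.symm_apply_eq,
    quotientRingEquiv_canonicalMap, h1]
  rfl

end Criterion

/-! ### Extension of derivations -/

namespace RingDerivation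

variable {A : Type u} [Ring A] (D : RingDerivation A)

theorem map_add (x y : A) : D (x + y) = D x + D y := _root_.map_add D.toAddMonoidHom x y

theorem map_one : D 1 = 0 := by
  have h := D.leibniz 1 1
  rw [mul_one, mul_one, one_mul] at h
  exact left_eq_add.1 h

theorem ext {D D' : RingDerivation A} (h : ∀ x, D x = D' x) : D = D' := by
  obtain ⟨d, _⟩ := D
  obtain ⟨d', _⟩ := D'
  obtain rfl : d = d' := AddMonoidHom.ext h
  rfl

end RingDerivation

section Extension

variable {R : Type u} [Ring R] {S : Type v} [Ring S] {f : R →+* S}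

theorem RingDerivation.eq_of_comp_eq (hf : HasDenominators f) {D D' : RingDerivation S}
    (h : ∀ r, D (f r) = D' (f r)) : D = D' := by
  refine RingDerivation.ext fun x => sub_eq_zero.1 ((hf x).1.eq_zero ?_)
  rintro i ⟨a, ha⟩
  have h1 := D.leibniz (f i) x
  have h2 := D'.leibniz (f i) x
  have h3 := h a
  rw [ha] at h3
  rw [← h3, h1, h i] at h2
  rw [mul_sub, sub_eq_zero]
  exact add_left_cancel h2

theorem exists_derivation_value (hf : HasDenominators f) (inj : Function.Injective f)
    (δ : RingDerivation R) (x : S) :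
    ∃ q, ∀ i a, f a = f i * x → f i * q = f (δ a) - f (δ i) * x := by
  have hl : ∀ i : leftDen f x, ∃ a, f a = f i.1 * x := fun i => i.2
  have hr : ∀ j : rightDen f x, ∃ a, f a = x * f j.1 := fun j => j.2
  choose F hF using hl
  choose G hG using hr
  obtain ⟨q, hq, -⟩ := exists_mul_eq_of_full (hf x).1 (hf x).2
    (F := fun i => open Classical in
      if hi : i ∈ leftDen f x then f (δ (F ⟨i, hi⟩)) - f (δ i) * x else 0)
    (G := fun j => open Classical in
      if hj : j ∈ rightDen f x then f (δ (G ⟨j, hj⟩)) - x * f (δ j) else 0)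
    (fun i hi j hj => by
      rw [dif_pos hi, dif_pos hj]
      have h1 : F ⟨i, hi⟩ * j = i * G ⟨j, hj⟩ := inj (by
        rw [map_mul, map_mul, hF, hG, mul_assoc])
      have h2 := congrArg (fun y => f (δ y)) h1
      simp only [δ.leibniz, map_add, map_mul, hF, hG] at h2
      rw [sub_mul, mul_sub, sub_eq_sub_iff_add_eq_add, ← mul_assoc, h2]
      simp only [mul_assoc]
      abel)
  refine ⟨q, fun i a ha => ?_⟩
  have hi : i ∈ leftDen f x := ⟨a, ha⟩
  rw [hq i hi, dif_pos hi, inj ((hF ⟨i, hi⟩).trans ha.symm)]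

theorem HasDenominators.exists_extension (hf : HasDenominators f) (inj : Function.Injective f)
    (δ : RingDerivation R) : ∃ D : RingDerivation S, ∀ r, D (f r) = f (δ r) := by
  choose D hD using exists_derivation_value hf inj δ
  refine ⟨⟨AddMonoidHom.mk' D fun x y => ?_, fun x y => ?_⟩, fun r => ?_⟩
  · rw [← sub_eq_zero]
    refine ((hf x).1.of_colon (J := leftDen f x ⊓ leftDen f y) ?_).eq_zero ?_
    · rintro i hi
      refine (hf (f i * y)).1.mono ?_
      rintro r ⟨a, ha⟩
      exact ⟨(leftDen f x).mul_mem_left r hi, a, by rw [ha, map_mul, mul_assoc]⟩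
    · rintro i ⟨⟨a, ha⟩, ⟨b, hb⟩⟩
      rw [mul_sub, mul_add, hD x i a ha, hD y i b hb,
        hD (x + y) i (a + b) (by rw [map_add, ha, hb, mul_add]), δ.map_add, map_add, mul_add]
      abel
  · change D (x * y) = D x * y + x * D y
    rw [← sub_eq_zero]
    refine (hf x).1.eq_zero fun i hi => ?_
    obtain ⟨a, ha⟩ := hi
    refine (hf (f a * y)).1.eq_zero fun r hr => ?_
    obtain ⟨b, hb⟩ := hr
    have h1 : f (r * a) = f (r * i) * x := by rw [map_mul, ha, map_mul, mul_assoc]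
    have h2 : f b = f (r * i) * (x * y) := by rw [hb, ha, map_mul]; simp only [mul_assoc]
    have h3 : f b = f (r * a) * y := by rw [hb, map_mul, mul_assoc]
    rw [← mul_assoc, ← map_mul, mul_sub, mul_add, hD _ _ b h2, ← mul_assoc _ (D x) y,
      hD _ _ _ h1, ← mul_assoc _ x (D y), ← h1, hD _ _ b h3, sub_mul, mul_assoc]
    abel
  · have := hD (f r) 1 r (by rw [map_one, one_mul])
    rw [map_one, one_mul, δ.map_one, map_zero, zero_mul, sub_zero] at this
    exact this

end Extension

/-! ### The total symmetric ring of quotients -/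

section Total

variable (R : Type u) [Ring R]

theorem toMaximal_injective : Function.Injective (toMaximal R) := by
  rw [injective_iff_map_eq_zero]
  intro x hx
  have h := quotientRingEquiv_canonicalMap (denseLeft R) (denseRight R) x
  rw [hx, map_zero] at h
  have h0 : toFree (denseLeft R) (denseRight R) x = 0 :=
    pairOf_injective (h.symm.trans (map_zero _).symm)
  rw [Ideal.Quotient.eq_zero_iff_mem, mem_torsionIdeal] at h0
  obtain ⟨⟨I, hI, h⟩, -⟩ := h0
  by_contra hne
  obtain ⟨r, hr, hr'⟩ := hI 1 x hne
  rw [mul_one] at hr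
  exact hr' (h r hr)

variable {R}

theorem codRestrict_injective {S : Subring (MaximalSymmetric R)}
    (h : ∀ r, toMaximal R r ∈ S) : Function.Injective ((toMaximal R).codRestrict S h) :=
  fun _ _ hab => toMaximal_injective R (congrArg Subtype.val hab)

variable (R) in
theorem range_mem_perfectSubrings : (toMaximal R).range ∈ perfectSubrings R := by
  refine ⟨fun r => ⟨r, rfl⟩, HasDenominators.isPerfectSymmetric ?_ (codRestrict_injective _)⟩
  rintro ⟨_, a, rfl⟩
  exact ⟨leftFull_top.mono fun r _ => ⟨r * a, map_mul _ _ _⟩,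
    rightFull_top.mono fun r _ => ⟨a * r, map_mul _ _ _⟩⟩

theorem toMaximal_mem_totalSymmetric (r : R) : toMaximal R r ∈ totalSymmetric R :=
  le_sSup (range_mem_perfectSubrings R) ⟨r, rfl⟩

theorem hasDenominators_totalSymmetric : HasDenominators
    ((toMaximal R).codRestrict (totalSymmetric R) toMaximal_mem_totalSymmetric) := by
  set f := (toMaximal R).codRestrict (totalSymmetric R) toMaximal_mem_totalSymmetric with hf
  have key : totalSymmetric R ≤ (denSubring f).map (totalSymmetric R).subtype := by
    refine sSup_le ?_
    rintro S ⟨h, Fl, Fr, hS⟩ s hs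
    have hle : S ≤ totalSymmetric R := le_sSup ⟨h, Fl, Fr, hS⟩
    exact ⟨_, hS.hasDenominators.map_mem_denSubring (Subring.inclusion hle) ⟨s, hs⟩, rfl⟩
  refine hasDenominators_of_denSubring_eq_top (eq_top_iff.2 fun x _ => ?_)
  obtain ⟨y, hy, hyx⟩ := key x.2
  rwa [← show y = x from Subtype.ext hyx]

end Total

end SymQuot

theorem mainTheorem4 (R : Type u) [Ring R] :
    (∀ F : Set (SymQuot.RightIdeal (SymQuot.Env R)),
      SymQuot.IsPerfectFilter F → SymQuot.IsDifferential F) ∧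
    IsGreatest (SymQuot.perfectSubrings R) (SymQuot.totalSymmetric R) ∧
    ∃ h : ∀ r : R, SymQuot.toMaximal R r ∈ SymQuot.totalSymmetric R,
      ∀ δ : SymQuot.RingDerivation R,
        ∃! D : SymQuot.RingDerivation (SymQuot.totalSymmetric R),
          ∀ r : R, D ⟨SymQuot.toMaximal R r, h r⟩ = ⟨SymQuot.toMaximal R (δ r), h (δ r)⟩ := by
  have hden := SymQuot.hasDenominators_totalSymmetric (R := R)
  have hinj := SymQuot.codRestrict_injective (SymQuot.toMaximal_mem_totalSymmetric (R := R))
  refine ⟨?_, ⟨⟨SymQuot.toMaximal_mem_totalSymmetric, hden.isPerfectSymmetric hinj⟩,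
    fun S hS => le_sSup hS⟩, SymQuot.toMaximal_mem_totalSymmetric, fun δ => ?_⟩
  · rintro F ⟨S, _, f, Fl, Fr, -, rfl⟩
    exact SymQuot.isDifferential_symmetricFilter Fl Fr
  · obtain ⟨D, hD⟩ := hden.exists_extension hinj δ
    exact ⟨D, hD, fun D' hD' => SymQuot.RingDerivation.eq_of_comp_eq hden fun r =>
      (hD' r).trans (hD r).symm⟩
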